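/- \textbf{Theorem (Law of large numbers).} Let $\Omega=\{0,1\}^{\mathbb Z}$ and let $D_\Omega[0,\infty)$ be the space of càdlàg paths $\xi=(\xi_t)_{t\ge 0}$ in $\Omega$, with the $\sigma$-algebra generated by the coordinates; $\xi_t(x)=1$ means that site $x$ is occupied at time $t$, $\xi_t(x)=0$ that it is vacant. Let $(P^\eta)_{\eta\in\Omega}$ be the laws of a time-homogeneous Markov process on $\Omega$ with paths in $D_\Omega[0,\infty)$ (for instance an interacting particle system), where $P^\eta$ is the law of the process started from $\eta$. For a probability measure $\mu$ on $\Omega$ put $P^\mu(\cdot)=\int_\Omega P^\eta(\cdot)\,\mu(\mathrm d\eta)$. Assume that $P^\mu$ is stationary and ergodic under the space-time shifts $(\theta_{x,s}\xi)_t(y)=\xi_{t+s}(y+x)$, $x\in\mathbb Z$, $s\ge 0$. Assume also that $P^\mu$ is cone-mixing, i.e., for all $\theta\in(0,\tfrac12\pi)$, $$\lim_{t\to\infty}\ \sup_{A\in\mathcal F_0,\ B\in\mathcal F_t^\theta,\ P^\mu(A)>0}\big|P^\mu(B\mid A)-P^\mu(B)\big|=0,$$ where $\mathcal F_0=\sigma\{\xi_0(x)\colon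 x\in\mathbb Z\}$, $\mathcal F_t^\theta=\sigma\{\xi_s(x)\colon (x,s)\in C_t^\theta\}$, and $$C_t^\theta=\big\{(x,s)\in\mathbb Z\times[0,\infty)\colon\ s-t\ \ge\ \sqrt{x^2+(s-t)^2}\,\cos\theta\big\}.$$ Let $\alpha,\beta\in(0,\infty)$. Given $\xi$, let $X=(X_t)_{t\ge 0}$ be the continuous-time nearest-neighbour random walk on $\mathbb Z$ with $X_0=0$ that at time $t$ jumps $$x\to x+1\ \text{ at rate }\ \alpha\,\xi_t(x)+\beta\,[1-\xi_t(x)],\qquad x\to x-1\ \text{ at rate }\ \beta\,\xi_t(x)+\alpha\,[1-\xi_t(x)].$$ Let $P^\xi_0$ be its law given $\xi$ (the quenched law), and let $\mathbb P_{\mu,0}(\cdot)=\int P^\xi_0(\cdot)\,P^\mu(\mathrm d\xi)$ be the annealed law. Then there exists a (deterministic) $v\in\mathbb R$ such that $$\lim_{t\to\infty}X_t/t=v\qquad \mathbb P_{\mu,0}\text{-a.s.}$$ -/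

import Mathlib

open MeasureTheory ProbabilityTheory Set Filter Topology
open scoped NNReal ENNReal

namespace RWDRE

/-! ### Path spaces -/

/-- Right-continuous functions on `[0,∞)` with left limits. At time `0` the left-limit condition is
void, because `𝓝[<] (0 : ℝ≥0)` is the trivial filter. -/
def IsCadlag {E : Type*} [TopologicalSpace E] (f : ℝ≥0 → E) : Prop :=
  ∀ t, ContinuousWithinAt f (Ici t) t ∧ ∃ l, Tendsto f (𝓝[<] t) (𝓝 l)

/-- The path space `D_E[0,∞)`. Its measurable structure is the one generated by the coordinate maps
`ξ ↦ ξ_t`. -/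
abbrev CadlagPath (E : Type*) [TopologicalSpace E] : Type _ := {f : ℝ≥0 → E // IsCadlag f}

/-- The configuration space `{0,1}^ℤ` with the product topology and product σ-algebra;
`true` means occupied, `false` means vacant. -/
abbrev Config : Type := ℤ → Bool

/-- Environment paths: `D_Ω[0,∞)`, with `Ω = {0,1}^ℤ`. The value `ξ_t(x)` is `ξ.1 t x`. -/
abbrev EnvPath : Type := CadlagPath Config

theorem IsCadlag.comp_add {E : Type*} [TopologicalSpace E] {f : ℝ≥0 → E} (hf : IsCadlag f)
    (s : ℝ≥0) : IsCadlag (fun t => f (t + s)) := by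
  intro t
  have hc : Continuous fun u : ℝ≥0 => u + s := by fun_prop
  refine ⟨?_, ?_⟩
  · refine (hf (t + s)).1.comp (t := Ici (t + s)) (f := fun u : ℝ≥0 => u + s)
      hc.continuousWithinAt ?_
    intro u hu
    exact add_le_add_left (mem_Ici.1 hu) s
  · obtain ⟨l, hl⟩ := (hf (t + s)).2
    refine ⟨l, hl.comp (tendsto_nhdsWithin_iff.2 ⟨?_, ?_⟩)⟩
    · exact (hc.tendsto t).mono_left nhdsWithin_le_nhds
    · filter_upwards [self_mem_nhdsWithin] with u hu
      exact add_lt_add_left (mem_Iio.1 hu) s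

theorem IsCadlag.continuous_comp {E F : Type*} [TopologicalSpace E] [TopologicalSpace F]
    {f : ℝ≥0 → E} (hf : IsCadlag f) {g : E → F} (hg : Continuous g) :
    IsCadlag (fun t => g (f t)) := by
  intro t
  refine ⟨hg.continuousAt.comp_continuousWithinAt (hf t).1, ?_⟩
  obtain ⟨l, hl⟩ := (hf t).2
  exact ⟨g l, (hg.tendsto l).comp hl⟩

/-- The space-time shift over `(x,s)`: `(θ_{x,s} ξ)_t(y) = ξ_{t+s}(y+x)`. -/
def shift (x : ℤ) (s : ℝ≥0) (ξ : EnvPath) : EnvPath :=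
  ⟨fun t y => ξ.1 (t + s) (y + x),
    (ξ.2.comp_add s).continuous_comp (g := fun (η : Config) y => η (y + x)) (by fun_prop)⟩

/-! ### The dynamic random environment -/

/-- The history up to time `s`: the σ-algebra generated by `ξ_u`, `0 ≤ u ≤ s`. -/
abbrev history (s : ℝ≥0) : MeasurableSpace EnvPath :=
  ⨆ u : Iic s, MeasurableSpace.comap (fun ξ : EnvPath => ξ.1 u.1) inferInstance

/-- A time-homogeneous Markov process on `Ω = {0,1}^ℤ` with càdlàg paths: a measurable family
`(P^η)` of probability measures on `D_Ω[0,∞)` with `P^η(ξ_0 = η) = 1` that satisfies the Markov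
property `P^η((ξ_{s+t})_{t ≥ 0} ∈ B | (ξ_u)_{u ≤ s}) = P^{ξ_s}(B)`. Every interacting particle
system on `{0,1}^ℤ` is of this form; the Feller property is not required. -/
structure ParticleSystem where
  law : Kernel Config EnvPath
  isMarkovKernel : IsMarkovKernel law
  start : ∀ η, ∀ᵐ ξ ∂(law η), ξ.1 0 = η
  markov : ∀ (η : Config) (s : ℝ≥0) (A B : Set EnvPath), MeasurableSet[history s] A →
    MeasurableSet B →
    law η (A ∩ shift 0 s ⁻¹' B) = ∫⁻ ξ in A, law (ξ.1 s) B ∂(law η)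

/-- The law `P^μ = ∫ P^η μ(dη)` of the environment with initial distribution `μ`. -/
noncomputable def ParticleSystem.pathLaw (S : ParticleSystem) (μ : Measure Config) :
    Measure EnvPath :=
  μ.bind S.law

/-- `P` is stationary under all space-time shifts `θ_{x,s}`, `x ∈ ℤ`, `s ≥ 0`. -/
def IsStationary (P : Measure EnvPath) : Prop :=
  ∀ (x : ℤ) (s : ℝ≥0), MeasurePreserving (shift x s) P P

/-- `P` is ergodic under space-time shifts: events that are invariant under all of them have
probability `0` or `1`. -/
def IsErgodic (P : Measure EnvPath) : Prop :=
  ∀ A : Set EnvPath, MeasurableSet A → (∀ (x : ℤ) (s : ℝ≥0), shift x s ⁻¹' A = A) →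
    P A = 0 ∨ P A = 1

/-! ### Cone-mixing -/

/-- The cone `C_t^θ = {u ∈ ℤ × [0,∞) : (u - tℓ, ℓ) ≥ ‖u - tℓ‖ cos θ}`, where `ℓ = (0,1)` and the
inner product and the norm are the Euclidean ones on `ℝ²`. -/
def cone (θ : ℝ) (t : ℝ≥0) : Set (ℤ × ℝ≥0) :=
  {u | √((u.1 : ℝ) ^ 2 + ((u.2 : ℝ) - t) ^ 2) * Real.cos θ ≤ (u.2 : ℝ) - t}

/-- `F_0 = σ{ξ_0(x) : x ∈ ℤ}`. -/
abbrev sigmaZero : MeasurableSpace EnvPath :=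
  ⨆ x : ℤ, MeasurableSpace.comap (fun ξ : EnvPath => ξ.1 0 x) inferInstance

/-- `F_t^θ = σ{ξ_s(x) : (x,s) ∈ C_t^θ}`. -/
abbrev sigmaCone (θ : ℝ) (t : ℝ≥0) : MeasurableSpace EnvPath :=
  ⨆ u : cone θ t, MeasurableSpace.comap (fun ξ : EnvPath => ξ.1 u.1.2 u.1.1) inferInstance

/-- `sup |P(B | A) - P(B)|` over `A ∈ F_0` with `P(A) > 0` and `B ∈ F_t^θ`. For a probability
measure `P` this is the supremum of a nonempty subset of `[0,1]`. -/
noncomputable def mixingCoeff (P : Measure EnvPath) (θ : ℝ) (t : ℝ≥0) : ℝ :=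
  sSup {r : ℝ | ∃ A B : Set EnvPath, MeasurableSet[sigmaZero] A ∧ MeasurableSet[sigmaCone θ t] B ∧
    0 < P A ∧ r = |(P[|A]).real B - P.real B|}

/-- Cone-mixing. -/
def IsConeMixing (P : Measure EnvPath) : Prop :=
  ∀ θ ∈ Ioo 0 (Real.pi / 2), Tendsto (mixingCoeff P θ) atTop (𝓝 0)

/-! ### The random walk

Given `ξ`, the walk at site `x` at time `t` jumps to `x + 1` at rate `rateRight α β (ξ_t(x))` and to
`x - 1` at rate `rateLeft α β (ξ_t(x))`. The total rate is always `α + β`. Hence the walk waits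
independent exponential times of parameter `α + β` between successive jumps, and a jump from `x` at
time `t` goes to `x ± 1` with probability proportional to the rates at `(x,t)`. The driving noise
`ω` consists of i.i.d. pairs of a waiting time `(ω n).1` and an independent uniform variable
`(ω n).2`, which decides on the direction of the jump. -/

/-- The rate `α ξ + β (1 - ξ)` of a jump to the right. -/
def rateRight (α β : ℝ) (b : Bool) : ℝ := if b then α else β

/-- The rate `β ξ + α (1 - ξ)` of a jump to the left. -/
def rateLeft (α β : ℝ) (b : Bool) : ℝ := if b then β else α

theorem rateRight_add_rateLeft (α β : ℝ) (b : Bool) :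
    rateRight α β b + rateLeft α β b = α + β := by
  cases b <;> simp [rateRight, rateLeft, add_comm]

/-- Waiting times and uniform variables. -/
abbrev Noise : Type := ℕ → ℝ × unitInterval

/-- The law of the noise: i.i.d. pairs, with independent components that are exponential with
parameter `r` and uniform on `[0,1]`. -/
noncomputable def noiseLaw (r : ℝ) : Measure Noise :=
  Measure.infinitePi fun _ => (expMeasure r).prod volume

/-- The time of the `n`-th jump (with `jumpTime ω 0 = 0`). -/
noncomputable def jumpTime (ω : Noise) (n : ℕ) : ℝ := ∑ i ∈ Finset.range n, (ω i).1

/-- The position of the walk after `n` jumps. The jump number `n + 1`, at time `t` from site `x`,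
goes to the right if and only if the uniform variable is below
`rateRight α β (ξ_t(x)) / (rateRight α β (ξ_t(x)) + rateLeft α β (ξ_t(x)))`. -/
noncomputable def jumpChain (α β : ℝ) (ξ : EnvPath) (ω : Noise) : ℕ → ℤ
  | 0 => 0
  | n + 1 =>
    let x := jumpChain α β ξ ω n
    let b := ξ.1 (jumpTime ω (n + 1)).toNNReal x
    if ((ω n).2 : ℝ) < rateRight α β b / (rateRight α β b + rateLeft α β b) then x + 1 else x - 1

/-- The number of jumps up to time `t`: the least `n` such that the jump number `n + 1` is
after `t`. -/
noncomputable def jumpCount (ω : Noise) (t : ℝ≥0) : ℕ := sInf {n : ℕ | (t : ℝ) < jumpTime ω (n + 1)}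

/-- The jump times are not bounded. This holds for almost every `ω`. -/
def NoExplosion (ω : Noise) : Prop := ∀ k : ℕ, ∃ n : ℕ, (k : ℝ) < jumpTime ω (n + 1)

open Classical in
/-- The position of the walk at time `t` (with the value `0` on the null set of noises with
explosion). -/
noncomputable def walk (α β : ℝ) (ξ : EnvPath) (ω : Noise) (t : ℝ≥0) : ℤ :=
  if NoExplosion ω then jumpChain α β ξ ω (jumpCount ω t) else 0

theorem NoExplosion.exists_lt {ω : Noise} (h : NoExplosion ω) (t : ℝ≥0) :
    ({n : ℕ | (t : ℝ) < jumpTime ω (n + 1)}).Nonempty := by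
  obtain ⟨k, hk⟩ := exists_nat_gt (t : ℝ)
  obtain ⟨n, hn⟩ := h k
  exact ⟨n, hk.trans hn⟩

theorem jumpCount_mono {ω : Noise} (h : NoExplosion ω) : Monotone (jumpCount ω) := by
  intro s t hst
  have := Nat.sInf_mem (h.exists_lt t)
  exact Nat.sInf_le (lt_of_le_of_lt (NNReal.coe_le_coe.2 hst) this)

theorem isCadlag_jumpCount {ω : Noise} (h : NoExplosion ω) : IsCadlag (jumpCount ω) := by
  intro t
  constructor
  · have hmem : (t : ℝ) < jumpTime ω (jumpCount ω t + 1) := Nat.sInf_mem (h.exists_lt t)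
    have hev : ∀ᶠ s : ℝ≥0 in 𝓝[≥] t, jumpCount ω s = jumpCount ω t := by
      have h1 : ∀ᶠ s : ℝ≥0 in 𝓝 t, (s : ℝ) < jumpTime ω (jumpCount ω t + 1) :=
        NNReal.continuous_coe.continuousAt.eventually_lt continuousAt_const hmem
      filter_upwards [nhdsWithin_le_nhds h1, self_mem_nhdsWithin] with s hs hts
      exact le_antisymm (Nat.sInf_le hs) (jumpCount_mono h hts)
    exact tendsto_const_nhds.congr' (hev.mono fun s hs => hs.symm)
  · rcases eq_or_ne t 0 with rfl | ht
    · refine ⟨0, ?_⟩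
      have : 𝓝[<] (0 : ℝ≥0) = ⊥ := by
        have : Iio (0 : ℝ≥0) = ∅ := by ext; simp
        rw [this, nhdsWithin_empty]
      rw [this]
      exact tendsto_bot
    · have hpos : (0 : ℝ≥0) < t := pos_iff_ne_zero.2 ht
      have hbdd : BddAbove (jumpCount ω '' Iio t) :=
        ⟨jumpCount ω t, by rintro _ ⟨s, hs, rfl⟩; exact jumpCount_mono h (le_of_lt hs)⟩
      have hne : (jumpCount ω '' Iio t).Nonempty := ⟨_, 0, hpos, rfl⟩
      obtain ⟨s₀, hs₀, hs₀'⟩ := Nat.sSup_mem hne hbdd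
      refine ⟨sSup (jumpCount ω '' Iio t), tendsto_const_nhds.congr' ?_⟩
      filter_upwards [self_mem_nhdsWithin,
        nhdsWithin_le_nhds (Ioi_mem_nhds (mem_Iio.1 hs₀))] with s hs hs'
      refine le_antisymm ?_ (le_csSup hbdd ⟨s, hs, rfl⟩)
      rw [← hs₀']
      exact jumpCount_mono h (le_of_lt hs')

theorem isCadlag_walk (α β : ℝ) (ξ : EnvPath) (ω : Noise) : IsCadlag (walk α β ξ ω) := by
  by_cases h : NoExplosion ω
  · have : walk α β ξ ω = fun t => jumpChain α β ξ ω (jumpCount ω t) := by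
      funext t; simp [walk, h]
    rw [this]
    exact (isCadlag_jumpCount h).continuous_comp continuous_of_discreteTopology
  · have : walk α β ξ ω = fun _ => 0 := by funext t; simp [walk, h]
    rw [this]
    exact fun t => ⟨continuousWithinAt_const, 0, tendsto_const_nhds⟩

/-- The walk as an element of `D_ℤ[0,∞)`. -/
noncomputable def walkPath (α β : ℝ) (p : EnvPath × Noise) : CadlagPath ℤ :=
  ⟨walk α β p.1 p.2, isCadlag_walk α β p.1 p.2⟩

/-! ### Measurability of the walk -/

theorem measurable_eval_env : Measurable fun p : EnvPath × ℝ≥0 => p.1.1 p.2 := by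
  let d : ℕ → ℝ≥0 → ℝ≥0 := fun n t => ((⌊t * (n + 1)⌋₊ + 1 : ℕ) : ℝ≥0) / (n + 1)
  have hd_gt : ∀ n t, t < d n t := by
    intro n t
    have hn : (0 : ℝ≥0) < n + 1 := by positivity
    rw [lt_div_iff₀ hn]
    exact_mod_cast Nat.lt_floor_add_one (t * (n + 1))
  have hd_le : ∀ n t, d n t ≤ t + 1 / (n + 1) := by
    intro n t
    have hn : (0 : ℝ≥0) < n + 1 := by positivity
    have h2 : ((⌊t * (n + 1)⌋₊ : ℕ) : ℝ≥0) ≤ t * (n + 1) := Nat.floor_le zero_le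
    rw [div_le_iff₀ hn, add_mul, div_mul_cancel₀ _ hn.ne']
    push_cast
    gcongr
  have hd_tendsto : ∀ t, Tendsto (fun n => d n t) atTop (𝓝[≥] t) := by
    intro t
    refine tendsto_nhdsWithin_iff.2 ⟨?_, Eventually.of_forall fun n => (hd_gt n t).le⟩
    have h1 : Tendsto (fun n : ℕ => t + 1 / ((n : ℝ≥0) + 1)) atTop (𝓝 (t + 0)) :=
      tendsto_const_nhds.add tendsto_one_div_add_atTop_nhds_zero_nat
    rw [add_zero] at h1
    exact tendsto_of_tendsto_of_tendsto_of_le_of_le tendsto_const_nhds h1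
      (fun n => (hd_gt n t).le) (fun n => hd_le n t)
  refine measurable_of_tendsto_metrizable (f := fun n p => p.1.1 (d n p.2)) ?_ ?_
  · intro n
    have h1 : Measurable fun q : EnvPath × ℕ => q.1.1 (((q.2 + 1 : ℕ) : ℝ≥0) / (n + 1)) := by
      refine measurable_from_prod_countable_left fun k => ?_
      exact (measurable_pi_apply (((k + 1 : ℕ) : ℝ≥0) / (n + 1))).comp measurable_subtype_coe
    have h2 : Measurable fun p : EnvPath × ℝ≥0 => (p.1, ⌊p.2 * (n + 1)⌋₊) :=
      measurable_fst.prodMk (Nat.measurable_floor.comp (measurable_snd.mul_const _))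
    exact h1.comp h2
  · rw [tendsto_pi_nhds]
    intro p
    exact (p.1.2 p.2).1.tendsto.comp (hd_tendsto p.2)

theorem measurable_jumpTime (n : ℕ) : Measurable fun ω : Noise => jumpTime ω n := by
  unfold jumpTime
  fun_prop

theorem measurable_jumpChain (α β : ℝ) (n : ℕ) :
    Measurable fun p : EnvPath × Noise => jumpChain α β p.1 p.2 n := by
  induction n with
  | zero => exact measurable_const
  | succ n ih =>
    have hη : Measurable fun p : EnvPath × Noise => p.1.1 (jumpTime p.2 (n + 1)).toNNReal :=
      measurable_eval_env.comp (measurable_fst.prodMk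
        ((measurable_jumpTime (n + 1)).comp measurable_snd).real_toNNReal)
    have hev : Measurable fun q : Config × ℤ => q.1 q.2 :=
      measurable_from_prod_countable_left fun k => measurable_pi_apply k
    have hb : Measurable fun p : EnvPath × Noise =>
        p.1.1 (jumpTime p.2 (n + 1)).toNNReal (jumpChain α β p.1 p.2 n) :=
      hev.comp (hη.prodMk ih)
    have hr : Measurable fun b : Bool =>
      rateRight α β b / (rateRight α β b + rateLeft α β b) := measurable_of_countable _
    have hu : Measurable fun p : EnvPath × Noise => ((p.2 n).2 : ℝ) :=
      measurable_subtype_coe.comp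
        (measurable_snd.comp ((measurable_pi_apply n).comp measurable_snd))
    exact Measurable.ite (measurableSet_lt hu (hr.comp hb)) (ih.add_const 1) (ih.sub_const 1)

theorem measurableSet_noExplosion : MeasurableSet {ω : Noise | NoExplosion ω} := by
  simp only [NoExplosion, ofPred_forall, ofPred_exists]
  exact MeasurableSet.iInter fun k => MeasurableSet.iUnion fun n =>
    measurableSet_lt measurable_const (measurable_jumpTime (n + 1))

theorem measurable_walkPath (α β : ℝ) : Measurable (walkPath α β) := by
  refine Measurable.subtype_mk (measurable_pi_iff.2 fun t => ?_)
  classical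
  have hset : MeasurableSet {p : EnvPath × Noise | NoExplosion p.2} :=
    measurable_snd measurableSet_noExplosion
  have hchain : Measurable fun q : (EnvPath × Noise) × ℕ => jumpChain α β q.1.1 q.1.2 q.2 :=
    measurable_from_prod_countable_left fun n => measurable_jumpChain α β n
  -- a version of the counting variable that is given by a minimum of a nonempty set
  let pr : EnvPath × Noise → ℕ → Prop :=
    fun p n => NoExplosion p.2 → (t : ℝ) < jumpTime p.2 (n + 1)
  have hex : ∀ p, ∃ n, pr p n := by
    intro p
    by_cases h : NoExplosion p.2
    · obtain ⟨n, hn⟩ := h.exists_lt t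
      exact ⟨n, fun _ => hn⟩
    · exact ⟨0, fun h' => absurd h' h⟩
  have hN : Measurable fun p => Nat.find (hex p) := by
    refine measurable_find hex fun n => ?_
    have hlt : MeasurableSet {p : EnvPath × Noise | (t : ℝ) < jumpTime p.2 (n + 1)} :=
      measurableSet_lt measurable_const ((measurable_jumpTime (n + 1)).comp measurable_snd)
    have : {p | pr p n} = {p : EnvPath × Noise | NoExplosion p.2}ᶜ ∪
        {p | (t : ℝ) < jumpTime p.2 (n + 1)} := by
      ext p
      simp only [pr, mem_ofPred_eq, mem_union, mem_compl_iff]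
      tauto
    rw [this]
    exact hset.compl.union hlt
  have key : Measurable fun p : EnvPath × Noise =>
      if NoExplosion p.2 then jumpChain α β p.1 p.2 (Nat.find (hex p)) else 0 :=
    Measurable.ite hset (hchain.comp (measurable_id.prodMk hN)) measurable_const
  convert key using 2 with p
  by_cases h : NoExplosion p.2
  · simp only [walk, h, if_true]
    congr 1
    refine le_antisymm (Nat.sInf_le ?_) (Nat.find_le ?_)
    · exact Nat.find_spec (hex p) h
    · exact fun _ => Nat.sInf_mem (h.exists_lt t)
  · simp [walk, h]

/-! ### Quenched and annealed laws of the walk -/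

theorem isProbabilityMeasure_noiseLaw {r : ℝ} (hr : 0 < r) :
    IsProbabilityMeasure (noiseLaw r) := by
  have := isProbabilityMeasure_expMeasure hr
  unfold noiseLaw
  infer_instance

instance (r : ℝ) : SFinite (noiseLaw r) := by
  by_cases h : ∀ _ : ℕ, IsProbabilityMeasure ((expMeasure r).prod (volume : Measure unitInterval))
  · unfold noiseLaw
    infer_instance
  · have : noiseLaw r = 0 := by
      unfold noiseLaw Measure.infinitePi
      exact dif_neg h
    rw [this]
    infer_instance

/-- The quenched law `P_0^ξ` of the walk started at `0`, as a kernel from `D_Ω[0,∞)` to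
`D_ℤ[0,∞)`. -/
noncomputable def quenchedLaw (α β : ℝ) : Kernel EnvPath (CadlagPath ℤ) where
  toFun ξ := (noiseLaw (α + β)).map fun ω => walkPath α β (ξ, ω)
  measurable' := by
    have h : (fun ξ => (noiseLaw (α + β)).map fun ω => walkPath α β (ξ, ω)) =
        fun ξ => ((noiseLaw (α + β)).map (Prod.mk ξ)).map (walkPath α β) := by
      funext ξ
      rw [Measure.map_map (measurable_walkPath α β) measurable_prodMk_left]
      rfl
    rw [h]
    exact (Measure.measurable_map _ (measurable_walkPath α β)).comp Measurable.map_prodMk_left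

theorem isMarkovKernel_quenchedLaw {α β : ℝ} (h : 0 < α + β) :
    IsMarkovKernel (quenchedLaw α β) := by
  have := isProbabilityMeasure_noiseLaw h
  exact ⟨fun ξ => Measure.isProbabilityMeasure_map
    ((measurable_walkPath α β).comp measurable_prodMk_left).aemeasurable⟩

/-- The annealed law `∫ P_0^ξ(·) P(dξ)` of the walk, when the environment has law `P`. -/
noncomputable def annealedLaw (α β : ℝ) (P : Measure EnvPath) : Measure (CadlagPath ℤ) :=
  P.bind (quenchedLaw α β)

end RWDRE

open RWDRE

/-!
The environment seen after a long waiting time of the walk is almost independent of the past, and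
this alone forces a law of large numbers; no regeneration times are needed.

The total jump rate is `α + β` everywhere, so the jump times depend on the noise only, and the walk
is observed along its jump chain `Y`. Let `L` be large. With probability `p > 0`, independently of
everything before, the waiting time after the `n`-th jump is at least `2L`. The cone at height `L`
above the present space-time point is wider than the speed of the jumps. Hence the walk, which sits
still until height `2L`, stays inside this cone for ever, except on an event of the noise whose
probability vanishes as `L → ∞` (`measurable_jumpChain_cone`, `tendsto_fastNoise`). By the Markov
property, cone-mixing with respect to `ξ_0` extends to the whole history
(`measure_history_inter_shift_cone_le`), so given the past the walk behaves after the long wait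
almost as it does in a fresh stationary environment, where the length of the wait is irrelevant by
stationarity in time. A long wait occurs after about `1/p` jumps. It follows that, for every
`δ > 0` and a suitable number `m` of jumps, the conditional mean of `Y_{n+m} - Y_n` given the past
differs from the constant `E Y_m` by at most `δ m`, uniformly in `n` and in the past
(`exists_integral_past_mul_displacement_le`). Conditioning is expressed by integration against
nonnegative functions of the past (`IsPastWeight`).

The increments over blocks of `m` jumps are bounded, so an exponential Chebyshev inequality, applied
to both signs, and the Borel-Cantelli lemma show that `Y_n / n` is eventually within `4δ` of
`E Y_m / m` (`ae_eventually_abs_jumpChain_div_sub_le`). As `δ` is arbitrary, `Y_n / n` converges to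
a constant. Finally the number of jumps up to time `t` is asymptotic to `(α + β) t`.
-/

namespace RWDRE

/-! ### Decoupling of the past from a remote cone -/

section Environment

variable {S : ParticleSystem} {μ : Measure Config}

theorem isProbabilityMeasure_pathLaw (S : ParticleSystem) (μ : Measure Config)
    [IsProbabilityMeasure μ] : IsProbabilityMeasure (S.pathLaw μ) := by
  have := S.isMarkovKernel
  unfold ParticleSystem.pathLaw
  infer_instance

theorem measurable_eval (s : ℝ≥0) : Measurable fun ξ : EnvPath => ξ.1 s :=
  (measurable_pi_apply s).comp measurable_subtype_coe

theorem measurable_eval_site (s : ℝ≥0) (x : ℤ) : Measurable fun ξ : EnvPath => ξ.1 s x :=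
  (measurable_pi_apply x).comp (measurable_eval s)

theorem measurable_shift (x : ℤ) (s : ℝ≥0) : Measurable (shift x s) := by
  refine Measurable.subtype_mk (measurable_pi_iff.2 fun t => measurable_pi_iff.2 fun y => ?_)
  exact measurable_eval_site (t + s) (y + x)

theorem shift_zero_time_comp (x : ℤ) (s : ℝ≥0) (ξ : EnvPath) :
    shift x 0 (shift 0 s ξ) = shift x s ξ := by
  refine Subtype.ext (funext fun t => funext fun y => ?_)
  simp [shift]

theorem history_le (s : ℝ≥0) : history s ≤ (inferInstance : MeasurableSpace EnvPath) :=
  iSup_le fun u => (measurable_eval u.1).comap_le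

theorem sigmaCone_le (θ : ℝ) (t : ℝ≥0) :
    sigmaCone θ t ≤ (inferInstance : MeasurableSpace EnvPath) :=
  iSup_le fun u => (measurable_eval_site u.1.2 u.1.1).comap_le

/-- The Markov property, integrated over the initial distribution. -/
theorem pathLaw_markov (S : ParticleSystem) (μ : Measure Config) (s : ℝ≥0) {A B : Set EnvPath}
    (hA : MeasurableSet[history s] A) (hB : MeasurableSet B) :
    S.pathLaw μ (A ∩ shift 0 s ⁻¹' B) = ∫⁻ ξ in A, S.law (ξ.1 s) B ∂(S.pathLaw μ) := by
  have hA' := history_le s A hA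
  have hf : Measurable fun ξ : EnvPath => S.law (ξ.1 s) B :=
    (S.law.measurable_coe hB).comp (measurable_eval s)
  rw [← lintegral_indicator hA']
  unfold ParticleSystem.pathLaw
  rw [Measure.bind_apply (hA'.inter (measurable_shift 0 s hB)) S.law.measurable.aemeasurable,
    Measure.lintegral_bind S.law.measurable.aemeasurable (hf.indicator hA').aemeasurable]
  refine lintegral_congr fun η => ?_
  rw [lintegral_indicator hA', S.markov η s A B hA hB]

/-- The joint law of the initial configuration and the path. -/
theorem pathLaw_start_inter (S : ParticleSystem) (μ : Measure Config) {C : Set Config}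
    {B : Set EnvPath} (hC : MeasurableSet C) (hB : MeasurableSet B) :
    S.pathLaw μ ((fun ξ => ξ.1 0) ⁻¹' C ∩ B) = ∫⁻ η in C, S.law η B ∂μ := by
  rw [← lintegral_indicator hC]
  unfold ParticleSystem.pathLaw
  rw [Measure.bind_apply ((measurable_eval 0 hC).inter hB) S.law.measurable.aemeasurable]
  refine lintegral_congr fun η => ?_
  by_cases h : η ∈ C
  · rw [indicator_of_mem h]
    refine measure_congr ?_
    filter_upwards [S.start η] with ξ hξ
    have : ξ ∈ (fun ξ : EnvPath => ξ.1 0) ⁻¹' C := by simpa [hξ] using h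
    exact propext ⟨fun hx => hx.2, fun hx => ⟨this, hx⟩⟩
  · rw [indicator_of_notMem h]
    refine measure_mono_null (t := {ξ : EnvPath | ¬ ξ.1 0 = η}) ?_ (S.start η)
    rintro ξ ⟨h1, -⟩ h2
    exact h (by simpa [h2] using h1)

theorem map_eval_pathLaw (hstat : IsStationary (S.pathLaw μ)) (s : ℝ≥0) :
    (S.pathLaw μ).map (fun ξ => ξ.1 s) = μ := by
  have h0 : (S.pathLaw μ).map (fun ξ => ξ.1 0) = μ := by
    ext C hC
    have := S.isMarkovKernel
    rw [Measure.map_apply (measurable_eval 0) hC]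
    have := pathLaw_start_inter S μ hC MeasurableSet.univ
    simpa using this
  refine Eq.trans ?_ h0
  conv_rhs => rw [← (hstat 0 s).map_eq, Measure.map_map (measurable_eval 0) (measurable_shift 0 s)]
  congr 1
  funext ξ
  simp [shift]

theorem mixingCoeff_nonneg (P : Measure EnvPath) (θ : ℝ) (t : ℝ≥0) : 0 ≤ mixingCoeff P θ t := by
  refine Real.sSup_nonneg ?_
  rintro r ⟨A, B, -, -, -, rfl⟩
  exact abs_nonneg _

theorem measure_inter_le_of_mixing (P : Measure EnvPath) [IsProbabilityMeasure P] (θ : ℝ)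
    (t : ℝ≥0) {A B : Set EnvPath} (hA : MeasurableSet[sigmaZero] A)
    (hB : MeasurableSet[sigmaCone θ t] B) :
    P (A ∩ B) ≤ (P B + ENNReal.ofReal (mixingCoeff P θ t)) * P A := by
  rcases eq_or_ne (P A) 0 with h0 | h0
  · rw [measure_mono_null inter_subset_left h0]
    exact zero_le
  have hpos : 0 < P A := pos_iff_ne_zero.2 h0
  have hAm : MeasurableSet A :=
    (iSup_le fun x => (measurable_eval_site 0 x).comap_le :
      sigmaZero ≤ (inferInstance : MeasurableSpace EnvPath)) A hA
  have hbdd : BddAbove {r : ℝ | ∃ A B : Set EnvPath, MeasurableSet[sigmaZero] A ∧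
      MeasurableSet[sigmaCone θ t] B ∧ 0 < P A ∧ r = |(P[|A]).real B - P.real B|} := by
    refine ⟨1, ?_⟩
    rintro r ⟨A, B, -, -, hA, rfl⟩
    have := cond_isProbabilityMeasure (μ := P) hA.ne'
    rw [abs_le]
    constructor <;>
    linarith [measureReal_nonneg (μ := P) (s := B), measureReal_nonneg (μ := P[|A]) (s := B),
      measureReal_le_one (μ := P) (s := B), measureReal_le_one (μ := P[|A]) (s := B)]
  have h1 : (P[|A]).real B - P.real B ≤ mixingCoeff P θ t :=
    (le_abs_self _).trans (le_csSup hbdd ⟨A, B, hA, hB, hpos, rfl⟩)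
  have := cond_isProbabilityMeasure (μ := P) hpos.ne'
  have h2 : (P[|A]) B ≤ P B + ENNReal.ofReal (mixingCoeff P θ t) := by
    rw [← ofReal_measureReal (μ := P[|A]) (s := B), ← ofReal_measureReal (μ := P) (s := B),
      ← ENNReal.ofReal_add measureReal_nonneg (mixingCoeff_nonneg P θ t)]
    exact ENNReal.ofReal_le_ofReal (by linarith)
  rw [← cond_mul_eq_inter hAm]
  exact mul_le_mul_left h2 _

theorem law_shift_cone_le [IsProbabilityMeasure μ] (hstat : IsStationary (S.pathLaw μ)) (θ : ℝ)
    (t : ℝ≥0) (y : ℤ) {B : Set EnvPath} (hB : MeasurableSet[sigmaCone θ t] B) :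
    ∀ᵐ η ∂μ, S.law η (shift y 0 ⁻¹' B) ≤
      S.pathLaw μ B + ENNReal.ofReal (mixingCoeff (S.pathLaw μ) θ t) := by
  have := isProbabilityMeasure_pathLaw S μ
  have hBm := sigmaCone_le θ t B hB
  refine ae_le_of_forall_setLIntegral_le_of_sigmaFinite
    (S.law.measurable_coe (measurable_shift y 0 hBm)) fun C hC _ => ?_
  rw [setLIntegral_const, ← pathLaw_start_inter S μ hC (measurable_shift y 0 hBm)]
  let C' : Set Config := {η | (fun x => η (x - y)) ∈ C}
  have hC' : MeasurableSet C' := by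
    have : Measurable fun (η : Config) (x : ℤ) => η (x - y) := by fun_prop
    exact this hC
  have hpre : (fun ξ : EnvPath => ξ.1 0) ⁻¹' C =
      shift y 0 ⁻¹' ((fun ξ : EnvPath => ξ.1 0) ⁻¹' C') := by
    ext ξ
    simp [C', shift]
  have hA : MeasurableSet[sigmaZero] ((fun ξ : EnvPath => ξ.1 0) ⁻¹' C') := by
    have : @Measurable _ _ sigmaZero _ (fun ξ : EnvPath => ξ.1 0) :=
      @measurable_pi_iff _ _ _ sigmaZero _ _ |>.2 fun x =>
        Measurable.of_comap_le (le_iSup (fun x : ℤ =>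
          MeasurableSpace.comap (fun ξ : EnvPath => ξ.1 0 x) inferInstance) x)
    exact this hC'
  have hAm : MeasurableSet ((fun ξ : EnvPath => ξ.1 0) ⁻¹' C') := measurable_eval 0 hC'
  have hμC : μ C = S.pathLaw μ ((fun ξ : EnvPath => ξ.1 0) ⁻¹' C') := by
    conv_lhs => rw [← map_eval_pathLaw hstat 0, Measure.map_apply (measurable_eval 0) hC, hpre]
    exact (hstat y 0).measure_preimage hAm.nullMeasurableSet
  rw [hpre, ← preimage_inter, (hstat y 0).measure_preimage (hAm.inter hBm).nullMeasurableSet, hμC]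
  exact measure_inter_le_of_mixing _ θ t hA hB

/-- Cone-mixing extends from the initial configuration to the whole history up to time `s`: given
`ξ_s`, the future does not depend on the rest of the history. -/
theorem measure_history_inter_shift_cone_le [IsProbabilityMeasure μ]
    (hstat : IsStationary (S.pathLaw μ)) (θ : ℝ) (t : ℝ≥0) (y : ℤ) (s : ℝ≥0) {A B : Set EnvPath}
    (hA : MeasurableSet[history s] A) (hB : MeasurableSet[sigmaCone θ t] B) :
    S.pathLaw μ (A ∩ shift y s ⁻¹' B) ≤
      (S.pathLaw μ B + ENNReal.ofReal (mixingCoeff (S.pathLaw μ) θ t)) * S.pathLaw μ A := by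
  have hBm := sigmaCone_le θ t B hB
  have h1 : shift y s ⁻¹' B = shift 0 s ⁻¹' (shift y 0 ⁻¹' B) := by
    ext ξ
    simp only [mem_preimage, shift_zero_time_comp]
  rw [h1, pathLaw_markov S μ s hA (measurable_shift y 0 hBm)]
  have h2 : ∀ᵐ ξ ∂(S.pathLaw μ), S.law (ξ.1 s) (shift y 0 ⁻¹' B) ≤
      S.pathLaw μ B + ENNReal.ofReal (mixingCoeff (S.pathLaw μ) θ t) := by
    refine ae_of_ae_map (p := fun η => S.law η (shift y 0 ⁻¹' B) ≤
      S.pathLaw μ B + ENNReal.ofReal (mixingCoeff (S.pathLaw μ) θ t))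
      (measurable_eval s).aemeasurable ?_
    rw [map_eval_pathLaw hstat s]
    exact law_shift_cone_le hstat θ t y hB
  rw [← setLIntegral_const]
  exact lintegral_mono_ae (ae_restrict_of_ae h2)

theorem setIntegral_shift_cone_le [IsProbabilityMeasure μ]
    (hstat : IsStationary (S.pathLaw μ)) (θ : ℝ) (t : ℝ≥0) (y : ℤ) (s : ℝ≥0) {B : Set EnvPath}
    (hB : MeasurableSet[sigmaCone θ t] B) {z : EnvPath → ℝ} (hz : Measurable[history s] z)
    (hz0 : ∀ ξ, 0 ≤ z ξ) (hzi : Integrable z (S.pathLaw μ)) :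
    ∫ ξ in shift y s ⁻¹' B, z ξ ∂(S.pathLaw μ) ≤
      ((S.pathLaw μ).real B + mixingCoeff (S.pathLaw μ) θ t) * ∫ ξ, z ξ ∂(S.pathLaw μ) := by
  have := isProbabilityMeasure_pathLaw S μ
  set P := S.pathLaw μ with hP
  have hBm := measurable_shift y s (sigmaCone_le θ t B hB)
  set k : ℝ≥0∞ := P B + ENNReal.ofReal (mixingCoeff P θ t) with hk
  have hle : (P.restrict (shift y s ⁻¹' B)).trim (history_le s) ≤ k • P.trim (history_le s) := by
    refine @Measure.le_iff _ (history s) _ _ |>.2 fun A hA => ?_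
    rw [trim_measurableSet_eq _ hA, Measure.smul_apply, trim_measurableSet_eq _ hA,
      Measure.restrict_apply' hBm]
    exact measure_history_inter_shift_cone_le hstat θ t y s hA hB
  have hzE : Measurable[history s] fun ξ => ENNReal.ofReal (z ξ) :=
    ENNReal.measurable_ofReal.comp hz
  have h1 : ∫⁻ ξ in shift y s ⁻¹' B, ENNReal.ofReal (z ξ) ∂P ≤
      k * ∫⁻ ξ, ENNReal.ofReal (z ξ) ∂P := by
    rw [← lintegral_trim (history_le s) hzE, ← lintegral_trim (μ := P) (history_le s) hzE]
    exact (@lintegral_mono' _ (history s) _ _ hle _ _ le_rfl).trans_eq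
      (lintegral_smul_measure _ _)
  have hkfin : k ≠ ∞ := by finiteness
  have hfin : ∫⁻ ξ, ENNReal.ofReal (z ξ) ∂P ≠ ∞ := by
    rw [← ofReal_integral_eq_lintegral_ofReal hzi (Eventually.of_forall hz0)]
    finiteness
  rw [integral_eq_lintegral_of_nonneg_ae (Eventually.of_forall hz0)
      hzi.aestronglyMeasurable.restrict,
    integral_eq_lintegral_of_nonneg_ae (Eventually.of_forall hz0) hzi.aestronglyMeasurable]
  have hkr : P.real B + mixingCoeff P θ t = k.toReal := by
    rw [hk, ENNReal.toReal_add (by finiteness) (by finiteness),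
      ENNReal.toReal_ofReal (mixingCoeff_nonneg P θ t)]
    rfl
  rw [hkr, ← ENNReal.toReal_mul]
  exact ENNReal.toReal_mono (ENNReal.mul_ne_top hkfin hfin) h1

/-- Decoupling: an integer-valued function of the environment in the cone, of absolute value at
most `m`, is seen from a space-time point `(y, s)` almost as if it were independent of the history
up to time `s`. Only an upper bound is stated; the lower one is the upper bound for `-G`. -/
theorem integral_mul_shift_cone_le [IsProbabilityMeasure μ]
    (hstat : IsStationary (S.pathLaw μ)) (θ : ℝ) (t : ℝ≥0) (y : ℤ) (s : ℝ≥0) {G : EnvPath → ℤ}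
    (hG : Measurable[sigmaCone θ t] G) {m : ℕ} (hGm : ∀ ξ, |G ξ| ≤ m) {z : EnvPath → ℝ}
    (hz : Measurable[history s] z) (hz0 : ∀ ξ, 0 ≤ z ξ) (hzi : Integrable z (S.pathLaw μ)) :
    ∫ ξ, z ξ * G (shift y s ξ) ∂(S.pathLaw μ) ≤
      (∫ ξ, (G ξ : ℝ) ∂(S.pathLaw μ) + 2 * m * mixingCoeff (S.pathLaw μ) θ t) *
        ∫ ξ, z ξ ∂(S.pathLaw μ) := by
  have := isProbabilityMeasure_pathLaw S μ
  set P := S.pathLaw μ with hP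
  -- the layers of `G + m`, which takes its values in `{0, …, 2m}`
  let B : ℕ → Set EnvPath := fun j => {ξ | (j : ℤ) < G ξ + m}
  have hB : ∀ j, MeasurableSet[sigmaCone θ t] (B j) := fun j =>
    hG (MeasurableSet.of_discrete (s := {g : ℤ | (j : ℤ) < g + m}))
  have hBm : ∀ j, MeasurableSet (B j) := fun j => sigmaCone_le θ t _ (hB j)
  have hlayer : ∀ ξ, (G ξ : ℝ) = ∑ j ∈ Finset.range (2 * m), (B j).indicator 1 ξ - m := by
    intro ξ
    obtain ⟨h1, h2⟩ := abs_le.1 (hGm ξ)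
    obtain ⟨k, hk⟩ := Int.eq_ofNat_of_zero_le (by linarith : 0 ≤ G ξ + m)
    have hk2 : k ≤ 2 * m := by omega
    have hG' : (G ξ : ℝ) = k - m := by
      rw [eq_sub_iff_add_eq]; exact_mod_cast hk
    have : ∑ j ∈ Finset.range (2 * m), (B j).indicator (1 : EnvPath → ℝ) ξ = k := by
      simp only [B, indicator_apply, mem_ofPred_eq, hk, Nat.cast_lt, Pi.one_apply, Finset.sum_boole]
      have : Finset.filter (fun j => j < k) (Finset.range (2 * m)) = Finset.range k := by
        ext j; simp only [Finset.mem_filter, Finset.mem_range]; omega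
      simp [this]
    rw [this, hG']
  have hint : ∀ j, Integrable ((B j).indicator (1 : EnvPath → ℝ)) P := fun j =>
    (integrable_const (1 : ℝ)).indicator (hBm j)
  have hEG : ∫ ξ, (G ξ : ℝ) ∂P = ∑ j ∈ Finset.range (2 * m), P.real (B j) - m := by
    simp_rw [hlayer]
    rw [integral_sub (integrable_finsetSum _ fun j _ => hint j) (integrable_const _),
      integral_finsetSum _ fun j _ => hint j]
    simp [integral_indicator_one (hBm _)]
  have hsh := fun j => measurable_shift y s (hBm j)
  have hprod : ∀ ξ, z ξ * (G (shift y s ξ) : ℝ) =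
      ∑ j ∈ Finset.range (2 * m), (shift y s ⁻¹' B j).indicator z ξ - m * z ξ := by
    intro ξ
    rw [hlayer (shift y s ξ), mul_sub, Finset.mul_sum, mul_comm (z ξ) (m : ℝ)]
    congr 1
    refine Finset.sum_congr rfl fun j _ => ?_
    by_cases h : shift y s ξ ∈ B j
    · rw [indicator_of_mem h, indicator_of_mem (mem_preimage.2 h)]; simp
    · rw [indicator_of_notMem h, indicator_of_notMem (by simpa using h)]; simp
  simp_rw [hprod]
  rw [integral_sub (integrable_finsetSum _ fun j _ => hzi.indicator (hsh j)) (hzi.const_mul _),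
    integral_finsetSum _ fun j _ => hzi.indicator (hsh j), integral_const_mul, hEG]
  have hsum : ∑ j ∈ Finset.range (2 * m), ∫ ξ, (shift y s ⁻¹' B j).indicator z ξ ∂P ≤
      ∑ j ∈ Finset.range (2 * m), (P.real (B j) + mixingCoeff P θ t) * ∫ ξ, z ξ ∂P := by
    refine Finset.sum_le_sum fun j _ => ?_
    rw [integral_indicator (hsh j)]
    exact setIntegral_shift_cone_le hstat θ t y s (hB j) hz hz0 hzi
  rw [← Finset.sum_mul, Finset.sum_add_distrib] at hsum
  simp only [Finset.sum_const, Finset.card_range, nsmul_eq_mul, Nat.cast_mul, Nat.cast_ofNat]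
    at hsum
  linarith

end Environment

/-! ### I.i.d. sequences: gluing a past to a future -/

section Glue

variable {X : Type*}

/-- The sequence that consists of the first `n` entries of `a`, followed by all entries of `b`. -/
def glue (n : ℕ) (a b : ℕ → X) : ℕ → X := fun i => if i < n then a i else b (i - n)

theorem glue_of_lt {n i : ℕ} (a b : ℕ → X) (h : i < n) : glue n a b i = a i := if_pos h

theorem glue_add (n i : ℕ) (a b : ℕ → X) : glue n a b (i + n) = b i := by simp [glue]

theorem measurable_glue [MeasurableSpace X] (n : ℕ) :
    Measurable fun p : (ℕ → X) × (ℕ → X) => glue n p.1 p.2 := by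
  refine measurable_pi_iff.2 fun i => ?_
  unfold glue
  split_ifs <;> fun_prop

/-- The first `n` terms of an i.i.d. sequence may be replaced by those of an independent copy. -/
theorem measurePreserving_glue [MeasurableSpace X] (ρ : Measure X) [IsProbabilityMeasure ρ]
    (n : ℕ) :
    MeasurePreserving (fun p : (ℕ → X) × (ℕ → X) => glue n p.1 p.2)
      ((Measure.infinitePi fun _ => ρ).prod (Measure.infinitePi fun _ => ρ))
      (Measure.infinitePi fun _ => ρ) := by
  refine ⟨measurable_glue n, Measure.eq_infinitePi _ fun s t ht => ?_⟩
  let s₁ : Finset ℕ := s.filter (· < n)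
  let s₂ : Finset ℕ := (s.filter fun i => ¬ i < n).image (· - n)
  have hpre : (fun p : (ℕ → X) × (ℕ → X) => glue n p.1 p.2) ⁻¹' (Set.pi s t) =
      (Set.pi s₁ t) ×ˢ (Set.pi s₂ fun j => t (j + n)) := by
    ext ⟨a, b⟩
    simp only [mem_preimage, mem_prod, Set.mem_pi, Finset.mem_coe, s₁, s₂, Finset.mem_filter,
      Finset.mem_image, glue]
    constructor
    · refine fun h => ⟨fun i hi => by simpa [hi.2] using h i hi.1, ?_⟩
      rintro j ⟨i, ⟨hi, hin⟩, rfl⟩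
      have := h i hi
      rw [if_neg hin] at this
      rwa [Nat.sub_add_cancel (not_lt.1 hin)]
    · rintro ⟨h1, h2⟩ i hi
      by_cases hin : i < n
      · rw [if_pos hin]; exact h1 i ⟨hi, hin⟩
      · rw [if_neg hin]
        have := h2 (i - n) ⟨i, ⟨hi, hin⟩, rfl⟩
        rwa [Nat.sub_add_cancel (not_lt.1 hin)] at this
  rw [Measure.map_apply (measurable_glue n) (MeasurableSet.pi s.countable_toSet fun i _ => ht i),
    hpre, Measure.prod_prod, Measure.infinitePi_pi _ fun i _ => ht i,
    Measure.infinitePi_pi _ fun i _ => ht (i + n)]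
  have himg : ∏ j ∈ s₂, ρ (t (j + n)) = ∏ i ∈ s.filter (fun i => ¬ i < n), ρ (t i) := by
    rw [Finset.prod_image]
    · refine Finset.prod_congr rfl fun i hi => ?_
      rw [Nat.sub_add_cancel (not_lt.1 (Finset.mem_filter.1 hi).2)]
    · intro i hi j hj hij
      have h1 := (Finset.mem_filter.1 hi).2
      have h2 := (Finset.mem_filter.1 hj).2
      simp only at hij
      omega
  rw [himg]
  exact Finset.prod_filter_mul_prod_filter_not s (· < n) fun i => ρ (t i)

/-- The shift of a sequence by `n` places. -/
def seqShift (n : ℕ) (a : ℕ → X) : ℕ → X := fun i => a (i + n)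

theorem seqShift_glue (n : ℕ) (a b : ℕ → X) : seqShift n (glue n a b) = b :=
  funext fun i => glue_add n i a b

theorem measurable_seqShift [MeasurableSpace X] (n : ℕ) :
    Measurable (seqShift n : (ℕ → X) → (ℕ → X)) := by
  unfold seqShift
  fun_prop

theorem integral_past_mul_future [MeasurableSpace X] (ρ : Measure X) [IsProbabilityMeasure ρ]
    (n : ℕ) {z f : (ℕ → X) → ℝ} (hz : Measurable z) (hf : Measurable f)
    (hpast : ∀ a b, (∀ i < n, a i = b i) → z a = z b) :
    ∫ a, z a * f (seqShift n a) ∂(Measure.infinitePi fun _ => ρ) =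
      (∫ a, z a ∂(Measure.infinitePi fun _ => ρ)) *
        ∫ a, f a ∂(Measure.infinitePi fun _ => ρ) := by
  have hm : Measurable fun a : ℕ → X => z a * f (seqShift n a) :=
    hz.mul (hf.comp (measurable_seqShift n))
  rw [← integral_prod_mul]
  conv_lhs => rw [← (measurePreserving_glue ρ n).map_eq]
  rw [integral_map (measurable_glue n).aemeasurable hm.aestronglyMeasurable]
  refine integral_congr_ae (Eventually.of_forall fun p => ?_)
  simp only [seqShift_glue]
  rw [hpast (glue n p.1 p.2) p.1 fun i hi => glue_of_lt _ _ hi]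

end Glue

/-! ### The driving noise -/

section NoiseLaw

variable {r : ℝ}

/-- A function of the noise that does not involve the first waiting time is independent of it. -/
theorem integral_indicator_first_mul (hr : 0 < r) {B : Set ℝ} (hB : MeasurableSet B)
    {f : Noise → ℝ} (hf : Measurable f)
    (hfirst : ∀ ω ω' : Noise, (ω 0).2 = (ω' 0).2 → (∀ i, ω (i + 1) = ω' (i + 1)) → f ω = f ω') :
    ∫ ω, B.indicator 1 (ω 0).1 * f ω ∂(noiseLaw r) =
      (expMeasure r).real B * ∫ ω, f ω ∂(noiseLaw r) := by
  have := isProbabilityMeasure_expMeasure hr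
  have := isProbabilityMeasure_noiseLaw hr
  let H : unitInterval × Noise → ℝ := fun q => f (glue 1 (fun _ => (0, q.1)) q.2)
  have hH : Measurable H := by
    refine hf.comp ((measurable_glue 1).comp (Measurable.prodMk ?_ measurable_snd))
    exact measurable_pi_iff.2 fun _ => measurable_const.prodMk measurable_fst
  have hglue : ∀ ω ω' : Noise, f (glue 1 ω ω') = H ((ω 0).2, ω') := by
    intro ω ω'
    refine hfirst _ _ (by simp [glue]) fun i => ?_
    rw [glue_add, glue_add]
  have hmp : MeasurePreserving (fun p : Noise × Noise => ((p.1 0).1, ((p.1 0).2, p.2)))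
      ((noiseLaw r).prod (noiseLaw r))
      ((expMeasure r).prod ((volume : Measure unitInterval).prod (noiseLaw r))) := by
    have h1 : MeasurePreserving (fun ω : Noise => ω 0) (noiseLaw r)
        ((expMeasure r).prod volume) :=
      measurePreserving_eval_infinitePi (fun _ => (expMeasure r).prod volume) 0
    exact (measurePreserving_prodAssoc _ _ _).comp (h1.prod (MeasurePreserving.id (noiseLaw r)))
  have key : ∀ g : ℝ → ℝ, Measurable g →
      ∫ ω, g (ω 0).1 * f ω ∂(noiseLaw r) = (∫ t, g t ∂(expMeasure r)) *
        ∫ q, H q ∂((volume : Measure unitInterval).prod (noiseLaw r)) := by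
    intro g hg
    have hm : Measurable fun ω : Noise => g (ω 0).1 * f ω :=
      (hg.comp (measurable_pi_apply 0).fst).mul hf
    have hm2 : Measurable fun q : ℝ × (unitInterval × Noise) => g q.1 * H q.2 :=
      (hg.comp measurable_fst).mul (hH.comp measurable_snd)
    have hgl : MeasurePreserving (fun p : Noise × Noise => glue 1 p.1 p.2)
      ((noiseLaw r).prod (noiseLaw r)) (noiseLaw r) := measurePreserving_glue _ 1
    rw [← integral_prod_mul, ← hmp.map_eq,
      integral_map hmp.measurable.aemeasurable hm2.aestronglyMeasurable]
    conv_lhs => rw [← hgl.map_eq]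
    rw [integral_map hgl.measurable.aemeasurable hm.aestronglyMeasurable]
    refine integral_congr_ae (Eventually.of_forall fun p => ?_)
    simp only [hglue, glue_of_lt p.1 p.2 one_pos]
  have h1 := key (B.indicator 1) (measurable_one.indicator hB)
  have h2 := key (fun _ => 1) measurable_const
  simp only [one_mul, integral_const, probReal_univ, smul_eq_mul, mul_one] at h2
  rw [h1, h2, integral_indicator_one hB]

theorem expMeasure_Ici_pos (hr : 0 < r) (x : ℝ) : 0 < (expMeasure r).real (Ici x) := by
  have := isProbabilityMeasure_expMeasure hr
  have h1 : (expMeasure r).real (Iic (max x 0)) = 1 - Real.exp (-(r * max x 0)) := by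
    have h := cdf_expMeasure_eq hr (max x 0)
    rwa [if_pos (le_max_right x 0), cdf_eq_real] at h
  have h2 : (expMeasure r).real (Iic (max x 0))ᶜ ≤ (expMeasure r).real (Ici x) := by
    refine measureReal_mono ?_
    intro y hy
    exact (le_max_left x 0).trans (not_le.1 (notMem_of_mem_compl hy)).le
  rw [probReal_compl_eq_one_sub measurableSet_Iic, h1] at h2
  linarith [Real.exp_pos (-(r * max x 0))]

theorem ae_nonneg_expMeasure (r : ℝ) : ∀ᵐ x ∂(expMeasure r), 0 ≤ x := by
  rw [ae_iff]
  have : {x : ℝ | ¬ 0 ≤ x} = Iio 0 := by ext; simp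
  rw [this, expMeasure, gammaMeasure, withDensity_apply _ measurableSet_Iio]
  exact lintegral_gammaPDF_of_nonpos le_rfl

theorem lintegral_id_expMeasure (hr : 0 < r) :
    ∫⁻ x, ENNReal.ofReal x ∂(expMeasure r) = ENNReal.ofReal r⁻¹ := by
  have hm : Measurable (gammaPDF 1 r) := (measurable_gammaPDFReal 1 r).ennreal_ofReal
  rw [expMeasure, gammaMeasure, lintegral_withDensity_eq_lintegral_mul _ hm (by fun_prop)]
  -- `x` times the density is `1/r` times the density of the gamma distribution of shape `2`
  have h : ∀ x, (gammaPDF 1 r * fun x => ENNReal.ofReal x) x =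
      ENNReal.ofReal r⁻¹ * gammaPDF 2 r x := by
    intro x
    rcases lt_or_ge x 0 with hx | hx
    · simp [gammaPDF_of_neg hx]
    · simp only [Pi.mul_apply, gammaPDF_of_nonneg hx]
      rw [← ENNReal.ofReal_mul (by
          have := Real.exp_pos (-(r * x)); simp only [Real.Gamma_one]; positivity),
        ← ENNReal.ofReal_mul (by positivity)]
      congr 1
      have : Real.Gamma 2 = 1 := Real.Gamma_two
      rw [this, Real.Gamma_one]
      norm_num
      field_simp
  simp_rw [h]
  have hm2 : Measurable (gammaPDF 2 r) := (measurable_gammaPDFReal 2 r).ennreal_ofReal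
  rw [lintegral_const_mul _ hm2,
    lintegral_gammaPDF_eq_one (by norm_num) hr, mul_one]

theorem ae_noise_nonneg (hr : 0 < r) : ∀ᵐ ω ∂(noiseLaw r), ∀ i, 0 ≤ (ω i).1 := by
  have := isProbabilityMeasure_expMeasure hr
  refine ae_all_iff.2 fun i => ?_
  have h1 : MeasurePreserving (fun ω : Noise => ω i) (noiseLaw r) ((expMeasure r).prod volume) :=
    measurePreserving_eval_infinitePi (fun _ => (expMeasure r).prod volume) i
  exact (Measure.quasiMeasurePreserving_fst.comp h1.quasiMeasurePreserving).ae
    (ae_nonneg_expMeasure r)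

/-- The law of large numbers for the jump times. -/
theorem ae_tendsto_jumpTime_div (hr : 0 < r) :
    ∀ᵐ ω ∂(noiseLaw r), Tendsto (fun n : ℕ => jumpTime ω n / n) atTop (𝓝 r⁻¹) := by
  have := isProbabilityMeasure_expMeasure hr
  have := isProbabilityMeasure_noiseLaw hr
  have hmp : ∀ i, MeasurePreserving (fun ω : Noise => (ω i).1) (noiseLaw r) (expMeasure r) := by
    intro i
    have h1 : MeasurePreserving (fun ω : Noise => ω i) (noiseLaw r)
        ((expMeasure r).prod volume) :=
      measurePreserving_eval_infinitePi (fun _ => (expMeasure r).prod volume) i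
    exact measurePreserving_fst.comp h1
  have hid : Integrable (fun x : ℝ => x) (expMeasure r) := by
    refine ⟨by fun_prop, ?_⟩
    rw [hasFiniteIntegral_iff_ofReal (ae_nonneg_expMeasure r), lintegral_id_expMeasure hr]
    exact ENNReal.ofReal_lt_top
  have hmean : ∫ ω, (ω 0).1 ∂(noiseLaw r) = r⁻¹ := by
    have h := integral_map (μ := noiseLaw r) (hmp 0).measurable.aemeasurable
      (f := fun x : ℝ => x) (by fun_prop)
    rw [← h, (hmp 0).map_eq, integral_eq_lintegral_of_nonneg_ae (ae_nonneg_expMeasure r)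
      (by fun_prop), lintegral_id_expMeasure hr, ENNReal.toReal_ofReal (by positivity)]
  have hind : iIndepFun (fun i (ω : Noise) => (ω i).1) (noiseLaw r) :=
    iIndepFun_infinitePi (X := fun _ (a : ℝ × unitInterval) => a.1) fun _ => measurable_fst
  have := strong_law_ae_real (fun i (ω : Noise) => (ω i).1)
    ((hmp 0).integrable_comp_of_integrable hid) (fun i j hij => hind.indepFun hij)
    (fun i => ⟨(hmp i).measurable.aemeasurable, (hmp 0).measurable.aemeasurable, by
      rw [(hmp i).map_eq, (hmp 0).map_eq]⟩)
  rw [hmean] at this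
  exact this

/-- The noises for which, for some `j`, the number `j` exceeds `c (L + t)`, where `t` is the time of
the `j`-th jump. -/
def fastNoise (c L : ℝ) : Set Noise := {ω | ∃ j : ℕ, c * (L + jumpTime ω j) < j}

theorem measurableSet_fastNoise (c L : ℝ) : MeasurableSet (fastNoise c L) := by
  simp only [fastNoise, ofPred_exists]
  exact MeasurableSet.iUnion fun j => measurableSet_lt
    (((measurable_jumpTime j).const_add L).const_mul c) measurable_const

theorem tendsto_fastNoise (hr : 0 < r) {c : ℝ} (hc : r < c) :
    Tendsto (fun L : ℕ => (noiseLaw r).real (fastNoise c L)) atTop (𝓝 0) := by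
  have := isProbabilityMeasure_noiseLaw hr
  have hc0 : 0 < c := hr.trans hc
  have h0 : noiseLaw r (⋂ L : ℕ, fastNoise c L) = 0 := by
    refine measure_mono_null (t := {ω | ¬ Tendsto (fun n : ℕ => jumpTime ω n / n) atTop (𝓝 r⁻¹)})
      (fun ω hω hlim => ?_) (ae_tendsto_jumpTime_div hr)
    have hev : ∀ᶠ n : ℕ in atTop, c⁻¹ < jumpTime ω n / n :=
      hlim.eventually_const_lt ((inv_lt_inv₀ hc0 hr).2 hc)
    obtain ⟨N, hN⟩ := eventually_atTop.1 hev
    -- beyond `N` the jump times are above the line of slope `1/c`; below `N` they are bounded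
    obtain ⟨L, hL⟩ := exists_nat_gt (∑ j ∈ Finset.range (N + 1), |j - c * jumpTime ω j| / c)
    obtain ⟨j, hj⟩ := mem_iInter.1 hω L
    rcases lt_or_ge N j with hNj | hNj
    · have h1 := hN j hNj.le
      have hjpos : (0 : ℝ) < j := by exact_mod_cast (Nat.zero_le N).trans_lt hNj
      rw [lt_div_iff₀ hjpos, inv_mul_lt_iff₀ hc0] at h1
      have : (0 : ℝ) ≤ c * L := by positivity
      linarith
    · have h1 : |j - c * jumpTime ω j| / c ≤
          ∑ j ∈ Finset.range (N + 1), |j - c * jumpTime ω j| / c :=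
        Finset.single_le_sum (f := fun j : ℕ => |j - c * jumpTime ω j| / c)
          (fun i _ => by positivity) (Finset.mem_range.2 (by omega))
      have h2 := h1.trans_lt hL
      rw [div_lt_iff₀ hc0] at h2
      have h3 := le_abs_self ((j : ℝ) - c * jumpTime ω j)
      linarith
  have hanti : Antitone fun L : ℕ => fastNoise c L := by
    rintro K L hKL ω ⟨j, hj⟩
    refine ⟨j, lt_of_le_of_lt ?_ hj⟩
    have : (K : ℝ) ≤ L := by exact_mod_cast hKL
    gcongr
  have := tendsto_measure_iInter_atTop (μ := noiseLaw r)
    (fun L : ℕ => (measurableSet_fastNoise c L).nullMeasurableSet) hanti ⟨0, by finiteness⟩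
  rw [h0] at this
  exact (ENNReal.tendsto_toReal_zero_iff (fun L => by finiteness)).2 this

end NoiseLaw

/-! ### The jump chain -/

section Chain

variable {α β : ℝ}

theorem jumpTime_add (ω : Noise) (n m : ℕ) :
    jumpTime ω (n + m) = jumpTime ω n + jumpTime (seqShift n ω) m := by
  simp only [jumpTime, seqShift, Finset.sum_range_add, add_comm _ n]

theorem jumpTime_nonneg {ω : Noise} (hω : ∀ i, 0 ≤ (ω i).1) (n : ℕ) : 0 ≤ jumpTime ω n :=
  Finset.sum_nonneg fun i _ => hω i

theorem jumpTime_mono {ω : Noise} (hω : ∀ i, 0 ≤ (ω i).1) : Monotone (jumpTime ω) :=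
  monotone_nat_of_le_succ fun n => by
    rw [jumpTime, jumpTime, Finset.sum_range_succ]
    linarith [hω n]

theorem abs_jumpChain_add_sub_le (ξ : EnvPath) (ω : Noise) (n m : ℕ) :
    |jumpChain α β ξ ω (n + m) - jumpChain α β ξ ω n| ≤ m := by
  induction m with
  | zero => simp
  | succ m ih =>
    have hstep : |jumpChain α β ξ ω (n + m + 1) - jumpChain α β ξ ω (n + m)| ≤ 1 := by
      rw [jumpChain]
      split_ifs <;> simp
    have := abs_sub_le (jumpChain α β ξ ω (n + m + 1)) (jumpChain α β ξ ω (n + m))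
      (jumpChain α β ξ ω n)
    rw [← add_assoc]
    push_cast
    linarith

theorem abs_jumpChain_le (ξ : EnvPath) (ω : Noise) (n : ℕ) : |jumpChain α β ξ ω n| ≤ n := by
  simpa [jumpChain] using abs_jumpChain_add_sub_le (α := α) (β := β) ξ ω 0 n

theorem jumpChain_congr (ξ : EnvPath) {ω ω' : Noise} {n : ℕ} (h : ∀ i < n, ω i = ω' i) :
    jumpChain α β ξ ω n = jumpChain α β ξ ω' n := by
  induction n with
  | zero => rfl
  | succ n ih =>
    have hT : jumpTime ω (n + 1) = jumpTime ω' (n + 1) :=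
      Finset.sum_congr rfl fun i hi => by rw [h i (Finset.mem_range.1 hi)]
    simp only [jumpChain, ih fun i hi => h i (hi.trans n.lt_succ_self), hT, h n n.lt_succ_self]

/-- After `n` jumps the chain starts afresh, in the environment seen from its position in
space-time. -/
theorem jumpChain_add (ξ : EnvPath) {ω : Noise} (hω : ∀ i, 0 ≤ (ω i).1) (n m : ℕ) :
    jumpChain α β ξ ω (n + m) = jumpChain α β ξ ω n +
      jumpChain α β (shift (jumpChain α β ξ ω n) (jumpTime ω n).toNNReal ξ) (seqShift n ω) m := by
  induction m with
  | zero => simp [jumpChain]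
  | succ m ih =>
    have hT : (jumpTime ω (n + m + 1)).toNNReal =
        (jumpTime (seqShift n ω) (m + 1)).toNNReal + (jumpTime ω n).toNNReal := by
      rw [add_assoc, jumpTime_add, add_comm]
      exact Real.toNNReal_add (jumpTime_nonneg (fun i => hω (i + n)) _) (jumpTime_nonneg hω n)
    rw [← add_assoc, jumpChain, jumpChain, ih, hT]
    simp only [shift, seqShift, add_comm m n, rateRight_add_rateLeft]
    rw [add_comm (jumpChain α β ξ ω n)]
    split_ifs <;> ring

/-- The first waiting time only shifts the environment in time. -/
theorem jumpChain_shift_first (ξ : EnvPath) {ω : Noise} (hω : ∀ i, 0 ≤ (ω i).1) (n : ℕ) :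
    jumpChain α β ξ ω n = jumpChain α β (shift 0 (ω 0).1.toNNReal ξ)
      (Function.update ω 0 (0, (ω 0).2)) n := by
  induction n with
  | zero => rfl
  | succ n ih =>
    have hT : jumpTime ω (n + 1) =
        jumpTime (Function.update ω 0 (0, (ω 0).2)) (n + 1) + (ω 0).1 := by
      simp [jumpTime, Finset.sum_range_succ']
    have hT0 : 0 ≤ jumpTime (Function.update ω 0 (0, (ω 0).2)) (n + 1) := by
      refine jumpTime_nonneg (fun i => ?_) _
      rcases Nat.eq_zero_or_pos i with rfl | hi
      · simp
      · rw [Function.update_of_ne hi.ne']; exact hω i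
    have hu : (Function.update ω 0 (0, (ω 0).2) n).2 = (ω n).2 := by
      rcases Nat.eq_zero_or_pos n with rfl | hn
      · simp
      · rw [Function.update_of_ne hn.ne']
    rw [jumpChain, jumpChain, ← ih, hT, Real.toNNReal_add hT0 (hω 0), hu]
    simp [shift]

/-- For a fixed noise, the chain is measurable with respect to the states that it may have
visited. -/
theorem measurable_jumpChain_of_visited {Ω : Type*} {mΩ : MeasurableSpace Ω} (E : Ω → EnvPath)
    (ω : Noise) (n : ℕ) (h : ∀ j < n, ∀ x : ℤ, |x| ≤ j →
      Measurable fun a => (E a).1 (jumpTime ω (j + 1)).toNNReal x) :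
    Measurable fun a => jumpChain α β (E a) ω n := by
  induction n with
  | zero => exact measurable_const
  | succ n ih =>
    have hY := ih fun j hj => h j (hj.trans n.lt_succ_self)
    have hb : Measurable fun a =>
        (E a).1 (jumpTime ω (n + 1)).toNNReal (jumpChain α β (E a) ω n) := by
      refine measurable_to_bool ?_
      have : (fun a => (E a).1 (jumpTime ω (n + 1)).toNNReal (jumpChain α β (E a) ω n)) ⁻¹' {true} =
          ⋃ x : ℤ, ⋃ _ : |x| ≤ n, {a | jumpChain α β (E a) ω n = x} ∩
            {a | (E a).1 (jumpTime ω (n + 1)).toNNReal x = true} := by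
        ext a
        simp only [mem_preimage, mem_singleton_iff, mem_iUnion, mem_inter_iff, mem_ofPred_eq]
        constructor
        · exact fun ha => ⟨_, abs_jumpChain_le (E a) ω n, rfl, ha⟩
        · rintro ⟨x, -, rfl, ha⟩
          exact ha
      rw [this]
      refine MeasurableSet.iUnion fun x => MeasurableSet.iUnion fun hx => ?_
      exact (hY (measurableSet_singleton x)).inter
        (h n n.lt_succ_self x hx (measurableSet_singleton true))
    let F : ℤ × Bool → ℤ := fun q =>
      if ((ω n).2 : ℝ) < rateRight α β q.2 / (rateRight α β q.2 + rateLeft α β q.2) then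
        q.1 + 1 else q.1 - 1
    exact (measurable_of_countable F).comp (hY.prodMk hb)

theorem measurable_jumpChain_history {ω : Noise} (hω : ∀ i, 0 ≤ (ω i).1) {n N : ℕ}
    (hn : n ≤ N) :
    Measurable[history (jumpTime ω N).toNNReal] fun ξ => jumpChain α β ξ ω n := by
  refine @measurable_jumpChain_of_visited α β _ (history (jumpTime ω N).toNNReal) id ω n
    fun j hj x _ => ?_
  have hle : (jumpTime ω (j + 1)).toNNReal ≤ (jumpTime ω N).toNNReal :=
    Real.toNNReal_mono (jumpTime_mono hω (by omega))
  have : Measurable[history (jumpTime ω N).toNNReal]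
      fun ξ : EnvPath => ξ.1 (jumpTime ω (j + 1)).toNNReal :=
    Measurable.of_comap_le (le_iSup (fun u : Iic (jumpTime ω N).toNNReal =>
      MeasurableSpace.comap (fun ξ : EnvPath => ξ.1 u.1) inferInstance) ⟨_, hle⟩)
  exact (measurable_pi_apply x).comp this

/-- If the first waiting time is at least `2L` and the further jumps are not too fast, then the
chain sees the environment only inside the cone at height `L`. -/
theorem measurable_jumpChain_cone {ω : Noise} (hω : ∀ i, 0 ≤ (ω i).1) {c : ℝ} (hc : 0 < c)
    {L : ℝ≥0} (hlong : 2 * (L : ℝ) ≤ (ω 0).1) (hslow : seqShift 1 ω ∉ fastNoise c L) (n : ℕ) :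
    Measurable[sigmaCone (Real.arctan c) L] fun ξ => jumpChain α β ξ ω n := by
  refine @measurable_jumpChain_of_visited α β _ (sigmaCone (Real.arctan c) L) id ω n
    fun j _ x hx => ?_
  have hmem : (x, (jumpTime ω (j + 1)).toNNReal) ∈ cone (Real.arctan c) L := by
    have hS : 0 ≤ jumpTime (seqShift 1 ω) j := jumpTime_nonneg (fun i => hω (i + 1)) j
    have hT : jumpTime ω (j + 1) = (ω 0).1 + jumpTime (seqShift 1 ω) j := by
      rw [add_comm, jumpTime_add]
      simp [jumpTime]
    have hj : (j : ℝ) ≤ c * (L + jumpTime (seqShift 1 ω) j) := by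
      by_contra hcon
      exact hslow ⟨j, not_le.1 hcon⟩
    have hx' : |(x : ℝ)| ≤ j := by exact_mod_cast hx
    set d : ℝ := jumpTime ω (j + 1) - L with hd
    have hLd : L + jumpTime (seqShift 1 ω) j ≤ d := by rw [hd, hT]; linarith
    have hd0 : 0 ≤ d := by linarith [L.2]
    have hxd : |(x : ℝ)| ≤ c * d :=
      hx'.trans (hj.trans (mul_le_mul_of_nonneg_left hLd hc.le))
    simp only [cone, mem_ofPred_eq, Real.coe_toNNReal _ (jumpTime_nonneg hω (j + 1)), ← hd,
      Real.cos_arctan]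
    rw [mul_one_div, div_le_iff₀ (by positivity), ← Real.sqrt_sq hd0,
      ← Real.sqrt_mul (by positivity)]
    refine Real.sqrt_le_sqrt ?_
    rw [Real.sqrt_sq hd0]
    have : (x : ℝ) ^ 2 ≤ (c * d) ^ 2 := sq_le_sq' (by linarith [neg_abs_le (x : ℝ)])
      ((le_abs_self _).trans hxd)
    nlinarith
  exact Measurable.of_comap_le (le_iSup (fun u : cone (Real.arctan c) L =>
      MeasurableSpace.comap (fun ξ : EnvPath => ξ.1 u.1.2 u.1.1) inferInstance) ⟨_, hmem⟩)

end Chain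

/-! ### The conditional mean displacement -/

section Displacement

variable {α β : ℝ}

theorem integrable_of_abs_le {Ω : Type*} {mΩ : MeasurableSpace Ω} {P : Measure Ω}
    [IsFiniteMeasure P] {f : Ω → ℝ} (hf : Measurable f) {C : ℝ} (hC : ∀ a, |f a| ≤ C) :
    Integrable f P :=
  Integrable.of_bound hf.aestronglyMeasurable C (Eventually.of_forall hC)

/-- The mean displacement over `m` jumps, for a fixed noise, in the random environment. -/
noncomputable def meanChain (α β : ℝ) (P : Measure EnvPath) (m : ℕ) (ω : Noise) : ℝ :=
  ∫ ξ, (jumpChain α β ξ ω m : ℝ) ∂P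

/-- The annealed mean displacement over `m` jumps. -/
noncomputable def annealedMean (α β : ℝ) (P : Measure EnvPath) (m : ℕ) : ℝ :=
  ∫ ω, meanChain α β P m ω ∂(noiseLaw (α + β))

theorem measurable_jumpChain_cast (α β : ℝ) (n : ℕ) :
    Measurable fun p : EnvPath × Noise => (jumpChain α β p.1 p.2 n : ℝ) :=
  (measurable_of_countable (fun k : ℤ => (k : ℝ))).comp (measurable_jumpChain α β n)

theorem measurable_meanChain (P : Measure EnvPath) [IsProbabilityMeasure P] (m : ℕ) :
    Measurable (meanChain α β P m) :=
  ((measurable_jumpChain_cast α β m).stronglyMeasurable.integral_prod_left' (μ := P)).measurable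

theorem abs_cast_jumpChain_le (ξ : EnvPath) (ω : Noise) (n : ℕ) :
    |(jumpChain α β ξ ω n : ℝ)| ≤ n := by
  exact_mod_cast abs_jumpChain_le ξ ω n

theorem abs_cast_jumpChain_add_sub_le (ξ : EnvPath) (ω : Noise) (n m : ℕ) :
    |(jumpChain α β ξ ω (n + m) : ℝ) - jumpChain α β ξ ω n| ≤ m := by
  exact_mod_cast abs_jumpChain_add_sub_le ξ ω n m

theorem abs_integral_le_of_abs_le {Ω : Type*} {mΩ : MeasurableSpace Ω} {P : Measure Ω}
    [IsProbabilityMeasure P] {f : Ω → ℝ} {C : ℝ} (hC : ∀ a, |f a| ≤ C) : |∫ a, f a ∂P| ≤ C := by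
  simpa using norm_integral_le_of_norm_le_const (μ := P) (f := f) (Eventually.of_forall hC)

theorem abs_meanChain_le (P : Measure EnvPath) [IsProbabilityMeasure P] (m : ℕ) (ω : Noise) :
    |meanChain α β P m ω| ≤ m :=
  abs_integral_le_of_abs_le fun ξ => abs_cast_jumpChain_le ξ ω m

theorem abs_annealedMean_le (h : 0 < α + β) (P : Measure EnvPath) [IsProbabilityMeasure P]
    (m : ℕ) : |annealedMean α β P m| ≤ m := by
  have := isProbabilityMeasure_noiseLaw h
  exact abs_integral_le_of_abs_le fun ω => abs_meanChain_le P m ω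

/-- By stationarity in time, the mean displacement does not depend on the first waiting time. -/
theorem meanChain_update_first {P : Measure EnvPath} (hstat : IsStationary P) (m : ℕ) {ω : Noise}
    (hω : ∀ i, 0 ≤ (ω i).1) :
    meanChain α β P m (Function.update ω 0 (0, (ω 0).2)) = meanChain α β P m ω := by
  unfold meanChain
  have hm : Measurable fun ξ : EnvPath =>
      (jumpChain α β ξ (Function.update ω 0 (0, (ω 0).2)) m : ℝ) :=
    (measurable_jumpChain_cast α β m).comp measurable_prodMk_right
  conv_lhs => rw [← (hstat 0 (ω 0).1.toNNReal).map_eq]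
  rw [integral_map (measurable_shift _ _).aemeasurable hm.aestronglyMeasurable]
  simp_rw [← jumpChain_shift_first _ hω]

/-- A bounded nonnegative function of the environment and the noise that depends only on the first
`n` steps of the walk: on the noise of these steps and on the environment until the `n`-th jump. -/
structure IsPastWeight (n : ℕ) (Z : EnvPath → Noise → ℝ) : Prop where
  measurable : Measurable fun p : EnvPath × Noise => Z p.1 p.2
  nonneg : ∀ ξ ω, 0 ≤ Z ξ ω
  bounded : ∃ C, ∀ ξ ω, Z ξ ω ≤ C
  history : ∀ ω : Noise, (∀ i, 0 ≤ (ω i).1) →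
    Measurable[RWDRE.history (jumpTime ω n).toNNReal] fun ξ => Z ξ ω
  past : ∀ ξ (ω ω' : Noise), (∀ i < n, ω i = ω' i) → Z ξ ω = Z ξ ω'

/-- The decoupling for the walk, averaged over the environment, for a fixed noise whose waiting time
after the `n`-th jump is long and whose further jumps are not too fast. -/
theorem integral_past_mul_displacement_le {S : ParticleSystem} {μ : Measure Config}
    [IsProbabilityMeasure μ] (hstat : IsStationary (S.pathLaw μ)) {n : ℕ}
    {Z : EnvPath → Noise → ℝ} (hZ : IsPastWeight n Z) {σ : ℤ} (hσ : |σ| ≤ 1) (m : ℕ)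
    {ω : Noise} (hω : ∀ i, 0 ≤ (ω i).1) {c : ℝ} (hc : 0 < c) {L : ℝ≥0}
    (hlong : 2 * (L : ℝ) ≤ (ω n).1) (hslow : seqShift (n + 1) ω ∉ fastNoise c L) :
    ∫ ξ, Z ξ ω * (σ * ((jumpChain α β ξ ω (n + m) : ℝ) - jumpChain α β ξ ω n)) ∂(S.pathLaw μ) ≤
      (σ * meanChain α β (S.pathLaw μ) m (seqShift n ω) +
        2 * m * mixingCoeff (S.pathLaw μ) (Real.arctan c) L) * ∫ ξ, Z ξ ω ∂(S.pathLaw μ) := by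
  have := isProbabilityMeasure_pathLaw S μ
  set P := S.pathLaw μ with hP
  set s := (jumpTime ω n).toNNReal with hs
  obtain ⟨C, hC⟩ := hZ.bounded
  have habs : ∀ ξ, |Z ξ ω| ≤ C := fun ξ => by rw [abs_of_nonneg (hZ.nonneg ξ ω)]; exact hC ξ ω
  let G : EnvPath → ℤ := fun ξ => σ * jumpChain α β ξ (seqShift n ω) m
  have hG : Measurable[sigmaCone (Real.arctan c) L] G := by
    have h1 : seqShift 1 (seqShift n ω) = seqShift (n + 1) ω := by
      funext i; simp [seqShift, add_assoc, add_comm 1]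
    have h2 := measurable_jumpChain_cone (α := α) (β := β) (ω := seqShift n ω) (fun i => hω (i + n))
      hc (L := L) (by simpa [seqShift] using hlong) (by rwa [h1]) m
    exact (measurable_of_countable (fun k : ℤ => σ * k)).comp h2
  have hGm : ∀ ξ, |G ξ| ≤ m := fun ξ => by
    rw [abs_mul]
    have := abs_jumpChain_le (α := α) (β := β) ξ (seqShift n ω) m
    have h0 := abs_nonneg (jumpChain α β ξ (seqShift n ω) m)
    nlinarith
  have hEG : ∫ ξ, (G ξ : ℝ) ∂P = σ * meanChain α β P m (seqShift n ω) := by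
    simp only [G, Int.cast_mul, meanChain]
    rw [integral_const_mul]
  let A : ℤ → Set EnvPath := fun y => {ξ | jumpChain α β ξ ω n = y}
  have hA : ∀ y, MeasurableSet[history s] (A y) := fun y =>
    measurable_jumpChain_history hω le_rfl (measurableSet_singleton y)
  have hAm : ∀ y, MeasurableSet (A y) := fun y => history_le s _ (hA y)
  let z : ℤ → EnvPath → ℝ := fun y => (A y).indicator fun ξ => Z ξ ω
  have hz : ∀ y, Measurable[history s] (z y) := fun y => (hZ.history ω hω).indicator (hA y)
  have hZm : Measurable fun ξ => Z ξ ω := hZ.measurable.comp measurable_prodMk_right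
  have hzi : ∀ y, Integrable (z y) P := fun y =>
    (integrable_of_abs_le hZm habs).indicator (hAm y)
  have hz0 : ∀ y ξ, 0 ≤ z y ξ := fun y ξ => indicator_nonneg (fun ξ _ => hZ.nonneg ξ ω) ξ
  -- the position after `n` jumps takes finitely many values
  let I : Finset ℤ := Finset.Icc (-n) n
  have hI : ∀ ξ, jumpChain α β ξ ω n ∈ I := fun ξ =>
    Finset.mem_Icc.2 (abs_le.1 (abs_jumpChain_le ξ ω n))
  have hsumz : ∀ (ξ : EnvPath) (g : ℤ → ℝ),
      ∑ y ∈ I, z y ξ * g y = Z ξ ω * g (jumpChain α β ξ ω n) := by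
    intro ξ g
    rw [Finset.sum_eq_single_of_mem _ (hI ξ)]
    · simp [z, A]
    · intro y _ hy
      have : ξ ∉ A y := fun h => hy (Eq.symm h)
      simp [z, indicator_of_notMem this]
  have hdisp : ∀ ξ, Z ξ ω * (σ * ((jumpChain α β ξ ω (n + m) : ℝ) - jumpChain α β ξ ω n)) =
      ∑ y ∈ I, z y ξ * G (shift y s ξ) := by
    intro ξ
    rw [hsumz ξ fun y => (G (shift y s ξ) : ℝ), jumpChain_add ξ hω n m]
    simp [G, hs]
  have hGi : ∀ y, Integrable (fun ξ => z y ξ * G (shift y s ξ)) P := by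
    intro y
    refine (hzi y).mul_bdd (c := m) ?_ (Eventually.of_forall fun ξ => ?_)
    · exact ((measurable_of_countable (fun k : ℤ => (k : ℝ))).comp
        ((hG.mono (sigmaCone_le _ _) le_rfl).comp (measurable_shift y s))).aestronglyMeasurable
    · rw [Real.norm_eq_abs]
      exact_mod_cast hGm (shift y s ξ)
  have hZsum : ∫ ξ, Z ξ ω ∂P = ∑ y ∈ I, ∫ ξ, z y ξ ∂P := by
    rw [← integral_finsetSum _ fun y _ => hzi y]
    refine integral_congr_ae (Eventually.of_forall fun ξ => ?_)
    simpa using (hsumz ξ fun _ => 1).symm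
  simp_rw [hdisp]
  rw [integral_finsetSum _ fun y _ => hGi y, hZsum, Finset.mul_sum, ← hEG]
  exact Finset.sum_le_sum fun y _ =>
    integral_mul_shift_cone_le hstat _ L y s hG hGm (hz y) (hz0 y) (hzi y)

end Displacement

/-! ### Loss of memory after a long waiting time -/

section Annealed

variable {α β : ℝ}

theorem IsPastWeight.abs_le {n : ℕ} {Z : EnvPath → Noise → ℝ} (hZ : IsPastWeight n Z) :
    ∃ C, 0 ≤ C ∧ ∀ ξ ω, |Z ξ ω| ≤ C := by
  obtain ⟨C, hC⟩ := hZ.bounded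
  refine ⟨max C 0, le_max_right _ _, fun ξ ω => ?_⟩
  rw [abs_of_nonneg (hZ.nonneg ξ ω)]
  exact (hC ξ ω).trans (le_max_left _ _)

theorem IsPastWeight.measurable_integral {n : ℕ} {Z : EnvPath → Noise → ℝ}
    (hZ : IsPastWeight n Z) (P : Measure EnvPath) [IsProbabilityMeasure P] :
    Measurable fun ω => ∫ ξ, Z ξ ω ∂P :=
  (hZ.measurable.stronglyMeasurable.integral_prod_left' (μ := P)).measurable

theorem IsPastWeight.integrable {n : ℕ} {Z : EnvPath → Noise → ℝ} (hZ : IsPastWeight n Z)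
    (h : 0 < α + β) (P : Measure EnvPath) [IsProbabilityMeasure P] :
    Integrable (fun p : EnvPath × Noise => Z p.1 p.2) (P.prod (noiseLaw (α + β))) := by
  have := isProbabilityMeasure_noiseLaw h
  obtain ⟨C, -, hC⟩ := hZ.abs_le
  exact integrable_of_abs_le hZ.measurable fun p => hC p.1 p.2

/-- A past weight is independent of the noise after the `n`-th jump. -/
theorem IsPastWeight.integral_mul_future {n : ℕ} {Z : EnvPath → Noise → ℝ}
    (hZ : IsPastWeight n Z) (h : 0 < α + β) (P : Measure EnvPath) [IsProbabilityMeasure P]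
    {f : Noise → ℝ} (hf : Measurable f) :
    ∫ ω, (∫ ξ, Z ξ ω ∂P) * f (seqShift n ω) ∂(noiseLaw (α + β)) =
      (∫ p, Z p.1 p.2 ∂(P.prod (noiseLaw (α + β)))) * ∫ ω, f ω ∂(noiseLaw (α + β)) := by
  have := isProbabilityMeasure_noiseLaw h
  have := isProbabilityMeasure_expMeasure h
  rw [integral_prod_symm _ (hZ.integrable h P)]
  refine integral_past_mul_future _ n (hZ.measurable_integral P) hf fun ω ω' hωω' => ?_
  exact integral_congr_ae (Eventually.of_forall fun ξ => hZ.past ξ ω ω' hωω')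

/-- The indicator of the event that the waiting time after the `n`-th jump is at least `ℓ`. -/
noncomputable def longWait (n : ℕ) (ℓ : ℝ) (ω : Noise) : ℝ := (Ici ℓ).indicator 1 (ω n).1

theorem measurable_longWait (n : ℕ) (ℓ : ℝ) : Measurable (longWait n ℓ) :=
  (measurable_one.indicator measurableSet_Ici).comp (measurable_pi_apply n).fst

theorem longWait_nonneg (n : ℕ) (ℓ : ℝ) (ω : Noise) : 0 ≤ longWait n ℓ ω :=
  indicator_nonneg (fun _ _ => zero_le_one) _

theorem longWait_le_one (n : ℕ) (ℓ : ℝ) (ω : Noise) : longWait n ℓ ω ≤ 1 :=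
  indicator_le_self' (fun _ _ => zero_le_one) _

theorem longWait_eq_zero {n : ℕ} {ℓ : ℝ} {ω : Noise} (h : ¬ ℓ ≤ (ω n).1) : longWait n ℓ ω = 0 :=
  indicator_of_notMem h _

theorem longWait_eq_one {n : ℕ} {ℓ : ℝ} {ω : Noise} (h : ℓ ≤ (ω n).1) : longWait n ℓ ω = 1 :=
  indicator_of_mem (s := Ici ℓ) h 1

/-- A past weight is independent of whether the next waiting time is long. -/
theorem IsPastWeight.integral_mul_longWait {n : ℕ} {Z : EnvPath → Noise → ℝ}
    (hZ : IsPastWeight n Z) (h : 0 < α + β) (P : Measure EnvPath) [IsProbabilityMeasure P]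
    (ℓ : ℝ) :
    ∫ p, Z p.1 p.2 * longWait n ℓ p.2 ∂(P.prod (noiseLaw (α + β))) =
      (expMeasure (α + β)).real (Ici ℓ) * ∫ p, Z p.1 p.2 ∂(P.prod (noiseLaw (α + β))) := by
  have := isProbabilityMeasure_noiseLaw h
  have hi : Integrable (fun p : EnvPath × Noise => Z p.1 p.2 * longWait n ℓ p.2)
      (P.prod (noiseLaw (α + β))) := by
    obtain ⟨C, hC0, hC⟩ := hZ.abs_le
    refine integrable_of_abs_le (C := C) (hZ.measurable.mul
      ((measurable_longWait n ℓ).comp measurable_snd)) fun p => ?_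
    rw [abs_mul, abs_of_nonneg (longWait_nonneg n ℓ p.2)]
    exact (mul_le_of_le_one_right (abs_nonneg _) (longWait_le_one n ℓ p.2)).trans (hC p.1 p.2)
  rw [integral_prod_symm _ hi]
  simp_rw [integral_mul_const]
  have h1 : ∀ ω : Noise, longWait n ℓ ω = longWait 0 ℓ (seqShift n ω) := fun ω => by
    simp [longWait, seqShift]
  simp_rw [h1]
  rw [hZ.integral_mul_future h P (measurable_longWait 0 ℓ), mul_comm]
  congr 1
  have := integral_indicator_first_mul h (measurableSet_Ici (a := ℓ)) (f := fun _ => 1)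
    measurable_const fun _ _ _ _ => rfl
  simpa [longWait] using this

/-- A past weight, restricted to the event that the next waiting time is short, is a past weight for
one more jump. -/
theorem IsPastWeight.mul_shortWait {n : ℕ} {Z : EnvPath → Noise → ℝ} (hZ : IsPastWeight n Z)
    (ℓ : ℝ) : IsPastWeight (n + 1) fun ξ ω => Z ξ ω * (1 - longWait n ℓ ω) where
  measurable := hZ.measurable.mul
    (((measurable_longWait n ℓ).comp measurable_snd).const_sub 1)
  nonneg ξ ω := mul_nonneg (hZ.nonneg ξ ω) (sub_nonneg.2 (longWait_le_one n ℓ ω))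
  bounded := by
    obtain ⟨C, hC⟩ := hZ.bounded
    refine ⟨C, fun ξ ω => (mul_le_of_le_one_right (hZ.nonneg ξ ω) ?_).trans (hC ξ ω)⟩
    linarith [longWait_nonneg n ℓ ω]
  history ω hω := by
    have hle : RWDRE.history (jumpTime ω n).toNNReal ≤
        RWDRE.history (jumpTime ω (n + 1)).toNNReal := by
      refine iSup_le fun u => ?_
      exact le_iSup (fun u : Iic (jumpTime ω (n + 1)).toNNReal =>
        MeasurableSpace.comap (fun ξ : EnvPath => ξ.1 u.1) inferInstance)
        ⟨u.1, u.2.trans (Real.toNNReal_mono (jumpTime_mono hω n.le_succ))⟩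
    exact ((hZ.history ω hω).mono hle le_rfl).mul_const _
  past ξ ω ω' hωω' := by
    simp only [longWait, hZ.past ξ ω ω' fun i hi => hωω' i (hi.trans n.lt_succ_self),
      hωω' n n.lt_succ_self]

variable {S : ParticleSystem} {μ : Measure Config} [IsProbabilityMeasure μ]

/-- The displacement over the `m` jumps after the `n`-th one, minus its annealed mean. -/
noncomputable def centredDisplacement (α β : ℝ) (P : Measure EnvPath) (n m : ℕ)
    (p : EnvPath × Noise) : ℝ :=
  (jumpChain α β p.1 p.2 (n + m) : ℝ) - jumpChain α β p.1 p.2 n - annealedMean α β P m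

theorem measurable_centredDisplacement (P : Measure EnvPath) (n m : ℕ) :
    Measurable (centredDisplacement α β P n m) :=
  ((measurable_jumpChain_cast α β (n + m)).sub (measurable_jumpChain_cast α β n)).sub_const _

theorem abs_centredDisplacement_le (h : 0 < α + β) (P : Measure EnvPath) [IsProbabilityMeasure P]
    (n m : ℕ) (p : EnvPath × Noise) : |centredDisplacement α β P n m p| ≤ 2 * m := by
  have h1 := abs_cast_jumpChain_add_sub_le (α := α) (β := β) p.1 p.2 n m
  have h2 := abs_annealedMean_le h P m
  unfold centredDisplacement
  refine (abs_sub _ _).trans ?_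
  linarith

theorem abs_sign_mul_centredDisplacement_le (h : 0 < α + β) (P : Measure EnvPath)
    [IsProbabilityMeasure P] (n m : ℕ) {σ : ℤ} (hσ : |σ| ≤ 1) (p : EnvPath × Noise) :
    |(σ : ℝ) * centredDisplacement α β P n m p| ≤ 2 * m := by
  have hσ' : |(σ : ℝ)| ≤ 1 := by exact_mod_cast hσ
  rw [abs_mul]
  exact (mul_le_of_le_one_left (abs_nonneg _) hσ').trans (abs_centredDisplacement_le h P n m p)

theorem IsPastWeight.integrable_mul {n k m : ℕ} {Z : EnvPath → Noise → ℝ}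
    (hZ : IsPastWeight n Z) (h : 0 < α + β) (P : Measure EnvPath) [IsProbabilityMeasure P]
    {σ : ℤ} (hσ : |σ| ≤ 1) :
    Integrable (fun p : EnvPath × Noise => Z p.1 p.2 * (σ * centredDisplacement α β P k m p))
      (P.prod (noiseLaw (α + β))) := by
  have := isProbabilityMeasure_noiseLaw h
  refine (hZ.integrable h P).mul_bdd (c := 2 * m) ?_ (Eventually.of_forall fun p => ?_)
  · exact ((measurable_centredDisplacement P k m).const_mul _).aestronglyMeasurable
  · exact abs_sign_mul_centredDisplacement_le h P k m hσ p

/-- If the waiting time after the `n`-th jump is long, then the walk forgets its past: it stays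
inside a cone whose apex is far above the present space-time point, and the environment in the cone
is almost independent of the history. -/
theorem integral_past_mul_longWait_mul_displacement_le (h : 0 < α + β)
    (hstat : IsStationary (S.pathLaw μ)) {n : ℕ} {Z : EnvPath → Noise → ℝ}
    (hZ : IsPastWeight n Z) {σ : ℤ} (hσ : |σ| ≤ 1) (m : ℕ) {c : ℝ} (hc : 0 < c) (L : ℝ≥0) :
    ∫ p, Z p.1 p.2 * longWait n (2 * L) p.2 *
        (σ * centredDisplacement α β (S.pathLaw μ) n m p)
        ∂((S.pathLaw μ).prod (noiseLaw (α + β))) ≤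
      (expMeasure (α + β)).real (Ici (2 * L)) *
        (2 * m * mixingCoeff (S.pathLaw μ) (Real.arctan c) L +
          2 * m * (noiseLaw (α + β)).real (fastNoise c L)) *
        ∫ p, Z p.1 p.2 ∂((S.pathLaw μ).prod (noiseLaw (α + β))) := by
  have := isProbabilityMeasure_pathLaw S μ
  have := isProbabilityMeasure_noiseLaw h
  have := isProbabilityMeasure_expMeasure h
  set P := S.pathLaw μ with hP
  set ν := noiseLaw (α + β) with hν
  set Φ := mixingCoeff P (Real.arctan c) L with hΦ
  have hΦ0 : 0 ≤ Φ := mixingCoeff_nonneg P _ _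
  set a := annealedMean α β P m with ha
  have hσ' : |(σ : ℝ)| ≤ 1 := by exact_mod_cast hσ
  have hW : Measurable fun p : EnvPath × Noise => longWait n (2 * (L : ℝ)) p.2 :=
    (measurable_longWait n _).comp measurable_snd
  let q : Noise → ℝ := fun ω => meanChain α β P m (Function.update ω 0 (0, (ω 0).2))
  have hupd : Measurable fun ω : Noise => Function.update ω 0 ((0 : ℝ), (ω 0).2) := by
    refine measurable_pi_iff.2 fun i => ?_
    rcases Nat.eq_zero_or_pos i with rfl | hi
    · simp only [Function.update_self]; fun_prop
    · simp only [Function.update_of_ne hi.ne']; fun_prop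
  have hq : Measurable q := (measurable_meanChain P m).comp hupd
  have hFm := measurableSet_fastNoise c (L : ℝ)
  let b : Noise → ℝ := fun ω => (fastNoise c (L : ℝ)).indicator 1 (seqShift 1 ω)
  have hb : Measurable b := (measurable_one.indicator hFm).comp (measurable_seqShift 1)
  have hb0 : ∀ ω, 0 ≤ b ω := fun ω => indicator_nonneg (fun _ _ => zero_le_one) _
  have hb1 : ∀ ω, b ω ≤ 1 := fun ω => indicator_le_self' (fun _ _ => zero_le_one) _
  let f : Noise → ℝ := fun ω => σ * (q ω - a) + 2 * m * Φ + 2 * m * b ω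
  have hf : Measurable f :=
    (((hq.sub_const a).const_mul _).add_const _).add (hb.const_mul _)
  have hqi : Integrable q ν := integrable_of_abs_le hq fun ω => abs_meanChain_le P m _
  have hbi : Integrable b ν := integrable_of_abs_le (C := 1) hb fun ω => by
    rw [abs_of_nonneg (hb0 ω)]; exact hb1 ω
  have hEq : ∫ ω, q ω ∂ν = a := by
    refine integral_congr_ae ?_
    filter_upwards [ae_noise_nonneg h] with ω hω
    exact meanChain_update_first hstat m hω
  have hEb : ∫ ω, b ω ∂ν = ν.real (fastNoise c L) := by
    have := integral_past_mul_future ((expMeasure (α + β)).prod (volume : Measure unitInterval)) 1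
      (z := fun _ => 1) measurable_const (measurable_one.indicator hFm) fun _ _ _ => rfl
    simp only [one_mul, integral_const, probReal_univ, smul_eq_mul] at this
    rw [← integral_indicator_one hFm]
    exact this
  have hEf : ∫ ω, f ω ∂ν = 2 * m * Φ + 2 * m * ν.real (fastNoise c L) := by
    have h1 : Integrable (fun ω => σ * (q ω - a)) ν := (hqi.sub (integrable_const a)).const_mul _
    have h2 : Integrable (fun ω => σ * (q ω - a) + 2 * m * Φ) ν := h1.add (integrable_const _)
    simp only [f]
    rw [integral_add h2 (hbi.const_mul _), integral_add h1 (integrable_const _),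
      integral_const_mul, integral_sub hqi (integrable_const a), hEq,
      integral_const_mul (2 * (m : ℝ)) b, hEb]
    simp
  have hfirst : ∀ ω ω' : Noise, (ω 0).2 = (ω' 0).2 → (∀ i, ω (i + 1) = ω' (i + 1)) →
      f ω = f ω' := by
    intro ω ω' h0 h1
    have e1 : Function.update ω 0 ((0 : ℝ), (ω 0).2) =
        Function.update ω' 0 ((0 : ℝ), (ω' 0).2) := by
      funext i
      cases i with
      | zero => simp [h0]
      | succ i => simp [h1 i]
    have e2 : seqShift 1 ω = seqShift 1 ω' := funext h1
    simp only [f, q, b, e1, e2]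
  have hfprod : ∫ ω, longWait 0 (2 * (L : ℝ)) ω * f ω ∂ν =
      (expMeasure (α + β)).real (Ici (2 * (L : ℝ))) * ∫ ω, f ω ∂ν :=
    integral_indicator_first_mul h measurableSet_Ici hf hfirst
  have hfbd : ∀ ω, |f ω| ≤ 2 * m + 2 * m * Φ + 2 * m := by
    intro ω
    have h1 : |(σ : ℝ) * (q ω - a)| ≤ 2 * m := by
      rw [abs_mul]
      refine (mul_le_of_le_one_left (abs_nonneg _) hσ').trans ((abs_sub _ _).trans ?_)
      linarith [abs_meanChain_le (α := α) (β := β) P m (Function.update ω 0 ((0 : ℝ), (ω 0).2)),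
        abs_annealedMean_le h P m]
    have h2 : |2 * m * b ω| ≤ 2 * m := by
      rw [abs_of_nonneg (mul_nonneg (by positivity) (hb0 ω))]
      exact mul_le_of_le_one_right (by positivity) (hb1 ω)
    have h3 : |2 * m * Φ| = 2 * m * Φ := abs_of_nonneg (by positivity)
    exact (abs_add_three _ _ _).trans (by linarith)
  obtain ⟨C, hC0, hC⟩ := hZ.abs_le
  have hζ := hZ.measurable_integral P
  -- the bound for a fixed noise
  have hfixed : ∀ᵐ ω ∂ν, ∫ ξ, Z ξ ω * longWait n (2 * L) ω *
      (σ * centredDisplacement α β P n m (ξ, ω)) ∂P ≤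
      (∫ ξ, Z ξ ω ∂P) * (longWait 0 (2 * (L : ℝ)) (seqShift n ω) * f (seqShift n ω)) := by
    filter_upwards [ae_noise_nonneg h] with ω hω
    have hW0 : longWait 0 (2 * (L : ℝ)) (seqShift n ω) = longWait n (2 * (L : ℝ)) ω := by
      simp [longWait, seqShift]
    by_cases hlong : 2 * (L : ℝ) ≤ (ω n).1
    · rw [hW0, longWait_eq_one hlong]
      simp only [mul_one, one_mul]
      have hZi : Integrable (fun ξ => Z ξ ω) P :=
        integrable_of_abs_le (hZ.measurable.comp measurable_prodMk_right) fun ξ => hC ξ ω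
      have hζ0 : 0 ≤ ∫ ξ, Z ξ ω ∂P := integral_nonneg fun ξ => hZ.nonneg ξ ω
      have hZD : Integrable (fun ξ => Z ξ ω * (σ * centredDisplacement α β P n m (ξ, ω))) P := by
        refine hZi.mul_bdd (c := 2 * m) ?_ (Eventually.of_forall fun ξ => ?_)
        · exact (((measurable_centredDisplacement P n m).comp
            measurable_prodMk_right).const_mul _).aestronglyMeasurable
        · exact abs_sign_mul_centredDisplacement_le h P n m hσ (ξ, ω)
      have hqω : q (seqShift n ω) = meanChain α β P m (seqShift n ω) :=
        meanChain_update_first hstat m fun i => hω (i + n)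
      have hshift : seqShift 1 (seqShift n ω) = seqShift (n + 1) ω := by
        funext i; simp [seqShift, add_assoc, add_comm 1]
      by_cases hslow : seqShift (n + 1) ω ∈ fastNoise c (L : ℝ)
      · have hbω : b (seqShift n ω) = 1 := by
          simp only [b, hshift]; exact indicator_of_mem hslow 1
        rw [← integral_mul_const]
        refine integral_mono hZD (hZi.mul_const _) fun ξ =>
          mul_le_mul_of_nonneg_left ?_ (hZ.nonneg ξ ω)
        have h1 : |(σ : ℝ) * (((jumpChain α β ξ ω (n + m) : ℝ) - jumpChain α β ξ ω n) -
            q (seqShift n ω))| ≤ 2 * m := by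
          rw [abs_mul]
          refine (mul_le_of_le_one_left (abs_nonneg _) hσ').trans ((abs_sub _ _).trans ?_)
          have h2 := abs_cast_jumpChain_add_sub_le (α := α) (β := β) ξ ω n m
          have h3 : |q (seqShift n ω)| ≤ m := abs_meanChain_le P m _
          linarith
        have h2 := (le_abs_self _).trans h1
        have h3 : 0 ≤ 2 * m * Φ := by positivity
        simp only [f, hbω, centredDisplacement, ← ha]
        linarith
      · have hbω : b (seqShift n ω) = 0 := by
          simp only [b, hshift]; exact indicator_of_notMem hslow 1
        have h1 := integral_past_mul_displacement_le hstat hZ hσ m hω hc hlong hslow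
          (α := α) (β := β)
        have h2 : ∫ ξ, Z ξ ω * (σ * centredDisplacement α β P n m (ξ, ω)) ∂P =
            ∫ ξ, Z ξ ω * (σ * ((jumpChain α β ξ ω (n + m) : ℝ) - jumpChain α β ξ ω n)) ∂P -
              σ * a * ∫ ξ, Z ξ ω ∂P := by
          rw [← integral_const_mul, ← integral_sub ?_ (hZi.const_mul _)]
          · refine integral_congr_ae (Eventually.of_forall fun ξ => ?_)
            simp only [centredDisplacement, ← ha]
            ring
          · refine (hZD.add (hZi.const_mul (σ * a))).congr (Eventually.of_forall fun ξ => ?_)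
            simp only [Pi.add_apply, centredDisplacement, ← ha]
            ring
        rw [h2]
        simp only [f, hbω, hqω]
        linarith
    · rw [hW0, longWait_eq_zero hlong]
      simp
  have hprodi : Integrable (fun p : EnvPath × Noise => Z p.1 p.2 * longWait n (2 * L) p.2 *
      (σ * centredDisplacement α β P n m p)) (P.prod ν) := by
    refine ((hZ.integrable_mul (k := n) (m := m) h P hσ).mul_bdd (c := 1)
      hW.aestronglyMeasurable (Eventually.of_forall fun p => ?_)).congr
      (Eventually.of_forall fun p => ?_)
    · rw [Real.norm_of_nonneg (longWait_nonneg n _ p.2)]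
      exact longWait_le_one n _ p.2
    · ring
  have hWf : Measurable fun ω => longWait 0 (2 * (L : ℝ)) ω * f ω :=
    (measurable_longWait 0 _).mul hf
  rw [integral_prod_symm _ hprodi]
  refine (integral_mono_ae hprodi.integral_prod_right ?_ hfixed).trans_eq ?_
  · have hζi : Integrable (fun ω => ∫ ξ, Z ξ ω ∂P) ν :=
      integrable_of_abs_le hζ fun ω => abs_integral_le_of_abs_le fun ξ => hC ξ ω
    refine hζi.mul_bdd (c := 2 * m + 2 * m * Φ + 2 * m)
      (hWf.comp (measurable_seqShift n)).aestronglyMeasurable (Eventually.of_forall fun ω => ?_)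
    rw [Real.norm_eq_abs, abs_mul, abs_of_nonneg (longWait_nonneg 0 _ _)]
    exact (mul_le_of_le_one_left (abs_nonneg _) (longWait_le_one 0 _ _)).trans (hfbd _)
  · rw [hZ.integral_mul_future h P hWf, hfprod, hEf]
    ring

theorem sign_mul_centredDisplacement_succ_le (P : Measure EnvPath) (n m : ℕ) {σ : ℤ}
    (hσ : |σ| ≤ 1) (p : EnvPath × Noise) :
    σ * centredDisplacement α β P n m p ≤ σ * centredDisplacement α β P (n + 1) m p + 2 := by
  have h1 := abs_cast_jumpChain_add_sub_le (α := α) (β := β) p.1 p.2 n 1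
  have h2 := abs_cast_jumpChain_add_sub_le (α := α) (β := β) p.1 p.2 (n + m) 1
  have hσ' : |(σ : ℝ)| ≤ 1 := by exact_mod_cast hσ
  have h3 : |(σ : ℝ) * (centredDisplacement α β P n m p -
      centredDisplacement α β P (n + 1) m p)| ≤ 2 := by
    rw [abs_mul]
    refine (mul_le_of_le_one_left (abs_nonneg _) hσ').trans ?_
    have : centredDisplacement α β P n m p - centredDisplacement α β P (n + 1) m p =
        ((jumpChain α β p.1 p.2 (n + 1) : ℝ) - jumpChain α β p.1 p.2 n) -
          ((jumpChain α β p.1 p.2 (n + m + 1) : ℝ) - jumpChain α β p.1 p.2 (n + m)) := by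
      unfold centredDisplacement
      rw [add_right_comm n 1 m]
      ring
    rw [this]
    refine (abs_sub _ _).trans ?_
    push_cast at h1 h2
    linarith
  have := (le_abs_self _).trans h3
  linarith

/-- The waiting times after the `n`-th jump are inspected one after another until a long one is
found. Each inspection costs at most `2` in the displacement, and it fails with probability `1 - p`,
where `p` is the probability of a long waiting time. After `K` failures the trivial bound is
used. -/
theorem integral_past_mul_displacement_le_add_pow (h : 0 < α + β)
    (hstat : IsStationary (S.pathLaw μ)) {σ : ℤ} (hσ : |σ| ≤ 1) (m : ℕ) {c : ℝ} (hc : 0 < c)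
    (L : ℝ≥0) {p e : ℝ} (hp : p = (expMeasure (α + β)).real (Ici (2 * L)))
    (he : e = 2 * m * mixingCoeff (S.pathLaw μ) (Real.arctan c) L +
          2 * m * (noiseLaw (α + β)).real (fastNoise c L)) (K : ℕ) :
    ∀ (n : ℕ) (Z : EnvPath → Noise → ℝ), IsPastWeight n Z →
    ∫ x, Z x.1 x.2 * (σ * centredDisplacement α β (S.pathLaw μ) n m x)
        ∂((S.pathLaw μ).prod (noiseLaw (α + β))) ≤
      (e + 2 / p + 2 * m * (1 - p) ^ K) *
        ∫ x, Z x.1 x.2 ∂((S.pathLaw μ).prod (noiseLaw (α + β))) := by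
  have := isProbabilityMeasure_pathLaw S μ
  have := isProbabilityMeasure_noiseLaw h
  have := isProbabilityMeasure_expMeasure h
  set P := S.pathLaw μ with hP
  have hp0 : 0 < p := hp ▸ expMeasure_Ici_pos h _
  have hp1 : p ≤ 1 := hp ▸ measureReal_le_one
  have he0 : 0 ≤ e := by
    have := mixingCoeff_nonneg P (Real.arctan c) L
    rw [he]
    positivity
  induction K with
  | zero =>
    intro n Z hZ
    have hZ0 : 0 ≤ ∫ x, Z x.1 x.2 ∂(P.prod (noiseLaw (α + β))) :=
      integral_nonneg fun x => hZ.nonneg x.1 x.2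
    have h1 : ∫ x, Z x.1 x.2 * (σ * centredDisplacement α β P n m x)
        ∂(P.prod (noiseLaw (α + β))) ≤
        ∫ x, Z x.1 x.2 * (2 * m) ∂(P.prod (noiseLaw (α + β))) :=
      integral_mono (hZ.integrable_mul h P hσ) ((hZ.integrable h P).mul_const _) fun x =>
        mul_le_mul_of_nonneg_left ((le_abs_self _).trans
          (abs_sign_mul_centredDisplacement_le h P n m hσ x)) (hZ.nonneg x.1 x.2)
    rw [integral_mul_const] at h1
    have h2 : 0 ≤ (e + 2 / p) * ∫ x, Z x.1 x.2 ∂(P.prod (noiseLaw (α + β))) := by positivity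
    rw [pow_zero]
    linarith
  | succ K ih =>
    intro n Z hZ
    set EZ := ∫ x, Z x.1 x.2 ∂(P.prod (noiseLaw (α + β))) with hEZ
    have hZ0 : 0 ≤ EZ := integral_nonneg fun x => hZ.nonneg x.1 x.2
    have hZ' := hZ.mul_shortWait (2 * L)
    have hlong := integral_past_mul_longWait_mul_displacement_le h hstat hZ hσ m hc L
    rw [← hP, ← hp, ← he, ← hEZ] at hlong
    have hshort := ih (n + 1) _ hZ'
    have hi1 := hZ'.integrable_mul (k := n + 1) (m := m) h P hσ
    have hi0 := hZ'.integrable_mul (k := n) (m := m) h P hσ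
    have hi2 := hZ.integrable_mul (k := n) (m := m) h P hσ
    have hi3 := hZ'.integrable h P
    have hEZ' : ∫ x, Z x.1 x.2 * (1 - longWait n (2 * L) x.2) ∂(P.prod (noiseLaw (α + β))) =
        (1 - p) * EZ := by
      have hi4 : Integrable (fun x : EnvPath × Noise => Z x.1 x.2 * longWait n (2 * L) x.2)
          (P.prod (noiseLaw (α + β))) :=
        ((hZ.integrable h P).sub hi3).congr (Eventually.of_forall fun x => by
          simp only [Pi.sub_apply]; ring)
      simp_rw [mul_sub, mul_one]
      rw [integral_sub (hZ.integrable h P) hi4, hZ.integral_mul_longWait h P, ← hp, ← hEZ]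
      ring
    have hstep : ∫ x, Z x.1 x.2 * (1 - longWait n (2 * L) x.2) *
        (σ * centredDisplacement α β P n m x) ∂(P.prod (noiseLaw (α + β))) ≤
        ∫ x, Z x.1 x.2 * (1 - longWait n (2 * L) x.2) *
        (σ * centredDisplacement α β P (n + 1) m x) ∂(P.prod (noiseLaw (α + β))) +
          2 * ((1 - p) * EZ) := by
      rw [← hEZ', ← integral_const_mul, ← integral_add hi1 (hi3.const_mul 2)]
      refine integral_mono hi0 (hi1.add (hi3.const_mul 2)) fun x => ?_
      have := mul_le_mul_of_nonneg_left
        (sign_mul_centredDisplacement_succ_le (α := α) (β := β) P n m hσ x) (hZ'.nonneg x.1 x.2)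
      linarith
    have hsplit : ∫ x, Z x.1 x.2 * (σ * centredDisplacement α β P n m x)
        ∂(P.prod (noiseLaw (α + β))) =
        ∫ x, Z x.1 x.2 * longWait n (2 * L) x.2 * (σ * centredDisplacement α β P n m x)
          ∂(P.prod (noiseLaw (α + β))) +
        ∫ x, Z x.1 x.2 * (1 - longWait n (2 * L) x.2) *
        (σ * centredDisplacement α β P n m x) ∂(P.prod (noiseLaw (α + β))) := by
      have hi5 : Integrable (fun x : EnvPath × Noise => Z x.1 x.2 * longWait n (2 * L) x.2 *
          (σ * centredDisplacement α β P n m x)) (P.prod (noiseLaw (α + β))) :=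
        (hi2.sub hi0).congr (Eventually.of_forall fun x => by
          simp only [Pi.sub_apply]; ring)
      rw [← integral_add hi5 hi0]
      exact integral_congr_ae (Eventually.of_forall fun x => by ring)
    rw [hEZ'] at hshort
    rw [hsplit]
    have hpp : p * (2 / p) = 2 := by field_simp
    have key : (1 - p) * (2 / p + 2) ≤ 2 / p := by
      have : (1 - p) * (2 / p + 2) = 2 / p - 2 * p := by
        linear_combination -hpp
      linarith
    have := mul_le_mul_of_nonneg_right key hZ0
    rw [pow_succ]
    linarith

/-- Asymptotic independence of displacements: over sufficiently many jumps, the conditional mean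
displacement per jump is close to the annealed one, uniformly in the past. -/
theorem exists_integral_past_mul_displacement_le (h : 0 < α + β)
    (hstat : IsStationary (S.pathLaw μ)) (hcone : IsConeMixing (S.pathLaw μ)) {δ : ℝ}
    (hδ : 0 < δ) :
    ∃ m : ℕ, 0 < m ∧ ∀ σ : ℤ, |σ| ≤ 1 → ∀ (n : ℕ) (Z : EnvPath → Noise → ℝ), IsPastWeight n Z →
    ∫ x, Z x.1 x.2 * (σ * centredDisplacement α β (S.pathLaw μ) n m x)
        ∂((S.pathLaw μ).prod (noiseLaw (α + β))) ≤
      δ * m * ∫ x, Z x.1 x.2 ∂((S.pathLaw μ).prod (noiseLaw (α + β))) := by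
  have := isProbabilityMeasure_pathLaw S μ
  have := isProbabilityMeasure_noiseLaw h
  have := isProbabilityMeasure_expMeasure h
  -- a slope above the jump rate
  set c := 2 * (α + β) with hcdef
  have hc : 0 < c := by positivity
  have hmix : Tendsto (fun L : ℕ => mixingCoeff (S.pathLaw μ) (Real.arctan c) (L : ℝ≥0)) atTop
      (𝓝 0) :=
    (hcone (Real.arctan c) ⟨Real.arctan_pos.2 hc, Real.arctan_lt_pi_div_two c⟩).comp
      tendsto_natCast_atTop_atTop
  have hfast := tendsto_fastNoise h (by linarith : α + β < c)
  have hsum : Tendsto (fun L : ℕ => 2 * mixingCoeff (S.pathLaw μ) (Real.arctan c) (L : ℝ≥0) +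
      2 * (noiseLaw (α + β)).real (fastNoise c L)) atTop (𝓝 0) := by
    simpa using (hmix.const_mul 2).add (hfast.const_mul 2)
  obtain ⟨L, hL⟩ := (hsum.eventually_lt_const (half_pos hδ)).exists
  set p := (expMeasure (α + β)).real (Ici (2 * ((L : ℝ≥0) : ℝ))) with hp
  have hp0 : 0 < p := expMeasure_Ici_pos h _
  have hp1 : p ≤ 1 := measureReal_le_one
  obtain ⟨m, hm⟩ := exists_nat_gt (4 / (p * δ))
  have hm0 : (0 : ℝ) < m := lt_trans (by positivity) hm
  refine ⟨m, by exact_mod_cast hm0, fun σ hσ n Z hZ => ?_⟩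
  set e := 2 * m * mixingCoeff (S.pathLaw μ) (Real.arctan c) (L : ℝ≥0) +
          2 * m * (noiseLaw (α + β)).real (fastNoise c ((L : ℝ≥0) : ℝ)) with he
  have hlim : Tendsto (fun K : ℕ => (e + 2 / p + 2 * m * (1 - p) ^ K) *
        ∫ x, Z x.1 x.2 ∂((S.pathLaw μ).prod (noiseLaw (α + β)))) atTop
      (𝓝 ((e + 2 / p + 2 * m * 0) *
        ∫ x, Z x.1 x.2 ∂((S.pathLaw μ).prod (noiseLaw (α + β))))) :=
    (((tendsto_pow_atTop_nhds_zero_of_lt_one (by linarith) (by linarith)).const_mul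
      (2 * (m : ℝ))).const_add _).mul_const _
  refine (ge_of_tendsto' hlim fun K =>
    integral_past_mul_displacement_le_add_pow h hstat hσ m hc L hp he K n Z hZ).trans ?_
  refine mul_le_mul_of_nonneg_right ?_ (integral_nonneg fun x => hZ.nonneg x.1 x.2)
  have h1 : e ≤ δ / 2 * m := by
    have := mul_le_mul_of_nonneg_right hL.le hm0.le
    rw [he, NNReal.coe_natCast]
    linarith
  have h2 : 2 / p ≤ δ / 2 * m := by
    rw [div_lt_iff₀ (by positivity)] at hm
    rw [div_le_iff₀ hp0]
    linarith
  linarith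

end Annealed

/-! ### The law of large numbers for the jump chain -/

section ChainLLN

variable {α β : ℝ}

/-- The displacement over the first `N` blocks of `m` jumps, minus `N` times the annealed mean
displacement over the first block. -/
noncomputable def blockDeviation (α β : ℝ) (P : Measure EnvPath) (m N : ℕ)
    (x : EnvPath × Noise) : ℝ :=
  (jumpChain α β x.1 x.2 (N * m) : ℝ) - N * annealedMean α β P m

theorem blockDeviation_succ (P : Measure EnvPath) (m N : ℕ) (x : EnvPath × Noise) :
    blockDeviation α β P m (N + 1) x =
      blockDeviation α β P m N x + centredDisplacement α β P (N * m) m x := by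
  simp only [blockDeviation, centredDisplacement, add_mul, one_mul]
  push_cast
  ring

theorem measurable_blockDeviation (P : Measure EnvPath) (m N : ℕ) :
    Measurable (blockDeviation α β P m N) :=
  (measurable_jumpChain_cast α β (N * m)).sub_const _

theorem isPastWeight_exp_blockDeviation (h : 0 < α + β) (P : Measure EnvPath)
    [IsProbabilityMeasure P] (m N : ℕ) (u : ℝ) :
    IsPastWeight (N * m) fun ξ ω => Real.exp (u * blockDeviation α β P m N (ξ, ω)) where
  measurable := ((measurable_blockDeviation P m N).const_mul u).exp
  nonneg ξ ω := (Real.exp_pos _).le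
  bounded := by
    refine ⟨Real.exp (|u| * (N * m + N * m)), fun ξ ω => Real.exp_le_exp.2 ?_⟩
    refine (le_abs_self _).trans ?_
    rw [abs_mul]
    refine mul_le_mul_of_nonneg_left ((abs_sub _ _).trans ?_) (abs_nonneg _)
    have h1 := abs_cast_jumpChain_le (α := α) (β := β) ξ ω (N * m)
    push_cast at h1
    refine add_le_add h1 ?_
    rw [abs_mul, Nat.abs_cast]
    exact mul_le_mul_of_nonneg_left (abs_annealedMean_le h P m) (Nat.cast_nonneg _)
  history ω hω := by
    have h1 := measurable_jumpChain_history (α := α) (β := β) hω (le_refl (N * m))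
    exact (measurable_of_countable fun k : ℤ =>
      Real.exp (u * ((k : ℝ) - N * annealedMean α β P m))).comp h1
  past ξ ω ω' hωω' := by
    simp only [blockDeviation, jumpChain_congr ξ hωω']

variable {P : Measure EnvPath} [IsProbabilityMeasure P]

/-- The exponential moments of the deviation grow at most like those of a sum of bounded increments
whose conditional means are small. -/
theorem mgf_blockDeviation_le (h : 0 < α + β) {δ : ℝ} {m : ℕ} {σ : ℤ} (hσ : |σ| ≤ 1)
    (hdisp : ∀ (n : ℕ) (Z : EnvPath → Noise → ℝ), IsPastWeight n Z →
      ∫ x, Z x.1 x.2 * (σ * centredDisplacement α β P n m x) ∂(P.prod (noiseLaw (α + β))) ≤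
        δ * m * ∫ x, Z x.1 x.2 ∂(P.prod (noiseLaw (α + β))))
    {u : ℝ} (hu : 0 ≤ u) (hum : u * (2 * m) ≤ 1) (N : ℕ) :
    mgf (fun x => σ * blockDeviation α β P m N x) (P.prod (noiseLaw (α + β))) u ≤
      Real.exp (N * (u * (δ * m) + (u * (2 * m)) ^ 2)) := by
  have := isProbabilityMeasure_noiseLaw h
  induction N with
  | zero => simp [mgf, blockDeviation, jumpChain]
  | succ N ih =>
    have hW := isPastWeight_exp_blockDeviation h P m N (u * σ)
    set W : EnvPath → Noise → ℝ := fun ξ ω =>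
      Real.exp (u * σ * blockDeviation α β P m N (ξ, ω)) with hWdef
    set E := ∫ x, W x.1 x.2 ∂(P.prod (noiseLaw (α + β))) with hE
    have hmgf : mgf (fun x => σ * blockDeviation α β P m N x) (P.prod (noiseLaw (α + β))) u =
        E := by
      simp only [mgf, hE, hWdef, mul_assoc]
    rw [hmgf] at ih
    have hE0 : 0 ≤ E := integral_nonneg fun x => (Real.exp_pos _).le
    have hWi := hW.integrable h P
    have hWD := hW.integrable_mul (k := N * m) (m := m) h P hσ
    have hWs := (isPastWeight_exp_blockDeviation h P m (N + 1) (u * σ)).integrable h P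
    set k := (u * (2 * m)) ^ 2 with hk
    have hpt : ∀ x, Real.exp (u * σ * blockDeviation α β P m (N + 1) x) ≤
        W x.1 x.2 * (1 + k) + u * (W x.1 x.2 * (σ * centredDisplacement α β P (N * m) m x)) := by
      intro x
      set d := σ * centredDisplacement α β P (N * m) m x with hd
      have hd1 : |u * d| ≤ u * (2 * m) := by
        rw [abs_mul, abs_of_nonneg hu]
        exact mul_le_mul_of_nonneg_left (abs_sign_mul_centredDisplacement_le h P _ m hσ x) hu
      have h1 := (le_abs_self _).trans (Real.abs_exp_sub_one_sub_id_le (hd1.trans hum))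
      have h2 : (u * d) ^ 2 ≤ k := by
        rw [← sq_abs]
        exact pow_le_pow_left₀ (abs_nonneg _) hd1 2
      have h3 : Real.exp (u * σ * blockDeviation α β P m (N + 1) x) =
          W x.1 x.2 * Real.exp (u * d) := by
        rw [hWdef, ← Real.exp_add, blockDeviation_succ, hd]
        congr 1
        ring
      rw [h3]
      have h4 : Real.exp (u * d) ≤ 1 + k + u * d := by linarith
      have h5 := mul_le_mul_of_nonneg_left h4 (hW.nonneg x.1 x.2)
      linarith
    have h1 : ∫ x, Real.exp (u * σ * blockDeviation α β P m (N + 1) x)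
        ∂(P.prod (noiseLaw (α + β))) ≤ E * (1 + k) + u * (δ * m * E) := by
      refine (integral_mono hWs ((hWi.mul_const _).add (hWD.const_mul u)) hpt).trans ?_
      simp only [Pi.add_apply]
      rw [integral_add (hWi.mul_const _) (hWD.const_mul u), integral_mul_const,
        integral_const_mul]
      have := mul_le_mul_of_nonneg_left (hdisp _ W hW) hu
      linarith
    have h2 : mgf (fun x => σ * blockDeviation α β P m (N + 1) x) (P.prod (noiseLaw (α + β))) u ≤
        E * (1 + k) + u * (δ * m * E) := by
      simpa only [mgf, mul_assoc] using h1
    have h3 : u * (δ * m) + k + 1 ≤ Real.exp (u * (δ * m) + k) := Real.add_one_le_exp _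
    calc _ ≤ E * (u * (δ * m) + k + 1) := by linarith
      _ ≤ Real.exp (N * (u * (δ * m) + k)) * Real.exp (u * (δ * m) + k) := by
          refine (mul_le_mul_of_nonneg_left h3 hE0).trans ?_
          exact mul_le_mul_of_nonneg_right ih (Real.exp_pos _).le
      _ = _ := by
          rw [← Real.exp_add]
          push_cast
          ring_nf

theorem ae_eventually_sign_mul_blockDeviation_lt (h : 0 < α + β) {δ : ℝ} (hδ : 0 < δ)
    (hδ1 : δ ≤ 1) {m : ℕ} (hm : 0 < m) {σ : ℤ} (hσ : |σ| ≤ 1)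
    (hdisp : ∀ (n : ℕ) (Z : EnvPath → Noise → ℝ), IsPastWeight n Z →
      ∫ x, Z x.1 x.2 * (σ * centredDisplacement α β P n m x) ∂(P.prod (noiseLaw (α + β))) ≤
        δ * m * ∫ x, Z x.1 x.2 ∂(P.prod (noiseLaw (α + β)))) :
    ∀ᵐ x ∂(P.prod (noiseLaw (α + β))), ∀ᶠ N : ℕ in atTop,
      σ * blockDeviation α β P m N x < 3 * δ * m * N := by
  have := isProbabilityMeasure_noiseLaw h
  have hm0 : (0 : ℝ) < m := by exact_mod_cast hm
  -- this choice makes the quadratic term of the exponential moment equal to the linear one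
  set u := δ / (4 * m) with hu
  have hu0 : 0 ≤ u := by positivity
  have hum : u * (2 * m) = δ / 2 := by rw [hu]; field_simp; norm_num
  have hud : u * (δ * m) = δ ^ 2 / 4 := by rw [hu]; field_simp
  let s : ℕ → Set (EnvPath × Noise) := fun N =>
    {x | 3 * δ * m * N ≤ σ * blockDeviation α β P m N x}
  have hs : ∀ N, P.prod (noiseLaw (α + β)) (s N) ≤
      ENNReal.ofReal (Real.exp (-(δ ^ 2 / 4)) ^ N) := by
    intro N
    have hint : Integrable (fun x => Real.exp (u * (σ * blockDeviation α β P m N x)))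
        (P.prod (noiseLaw (α + β))) := by
      simpa only [mul_assoc] using
        (isPastWeight_exp_blockDeviation h P m N (u * σ)).integrable h P
    have h1 := measure_ge_le_exp_mul_mgf (3 * δ * m * N) hu0 hint
    have h2 := mgf_blockDeviation_le h hσ hdisp hu0 (by rw [hum]; linarith) N
    rw [← ofReal_measureReal]
    refine ENNReal.ofReal_le_ofReal (h1.trans ?_)
    refine (mul_le_mul_of_nonneg_left h2 (Real.exp_pos _).le).trans_eq ?_
    rw [← Real.exp_add, ← Real.exp_nat_mul, hum, hud]
    congr 1
    have : u * (3 * δ * m * N) = 3 * (δ ^ 2 / 4) * N := by rw [← hud]; ring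
    rw [neg_mul, this]
    ring
  have hsum : ∑' N, P.prod (noiseLaw (α + β)) (s N) ≠ ∞ := by
    refine ne_top_of_le_ne_top ?_ (ENNReal.tsum_le_tsum hs)
    have hq : Real.exp (-(δ ^ 2 / 4)) < 1 := by
      rw [Real.exp_lt_one_iff]
      have := pow_pos hδ 2
      linarith
    exact (summable_geometric_of_lt_one (Real.exp_pos _).le hq).tsum_ofReal_ne_top
  filter_upwards [ae_eventually_notMem hsum] with x hx
  exact hx.mono fun N hN => not_le.1 hN

theorem ae_eventually_abs_jumpChain_div_sub_le (h : 0 < α + β) {δ : ℝ} (hδ : 0 < δ)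
    (hδ1 : δ ≤ 1) {m : ℕ} (hm : 0 < m)
    (hdisp : ∀ σ : ℤ, |σ| ≤ 1 → ∀ (n : ℕ) (Z : EnvPath → Noise → ℝ), IsPastWeight n Z →
      ∫ x, Z x.1 x.2 * (σ * centredDisplacement α β P n m x) ∂(P.prod (noiseLaw (α + β))) ≤
        δ * m * ∫ x, Z x.1 x.2 ∂(P.prod (noiseLaw (α + β)))) :
    ∀ᵐ x ∂(P.prod (noiseLaw (α + β))), ∀ᶠ n : ℕ in atTop,
      |(jumpChain α β x.1 x.2 n : ℝ) / n - annealedMean α β P m / m| ≤ 4 * δ := by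
  have hm0 : (0 : ℝ) < m := by exact_mod_cast hm
  filter_upwards [ae_eventually_sign_mul_blockDeviation_lt h hδ hδ1 hm (σ := 1) (by simp)
      (hdisp 1 (by simp)),
    ae_eventually_sign_mul_blockDeviation_lt h hδ hδ1 hm (σ := -1) (by simp)
      (hdisp (-1) (by simp))] with x hx1 hx2
  have hdiv : Tendsto (fun n : ℕ => n / m) atTop atTop := Nat.tendsto_div_const_atTop hm.ne'
  obtain ⟨n₀, hn₀⟩ := exists_nat_gt (2 * m / δ)
  filter_upwards [hdiv.eventually hx1, hdiv.eventually hx2, eventually_ge_atTop n₀,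
    eventually_gt_atTop 0] with n h1 h2 h3 h4
  set N := n / m with hN
  have hn0 : (0 : ℝ) < n := by exact_mod_cast h4
  set a := annealedMean α β P m with ha
  have hnN : n = N * m + n % m := by rw [hN, mul_comm]; exact (Nat.div_add_mod n m).symm
  have hmod : ((n % m : ℕ) : ℝ) ≤ m := by exact_mod_cast (Nat.mod_lt n hm).le
  have hNm : (N : ℝ) * m + (n % m : ℕ) = n := by exact_mod_cast hnN.symm
  have hD := abs_cast_jumpChain_add_sub_le (α := α) (β := β) x.1 x.2 (N * m) (n % m)
  rw [← hnN] at hD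
  have hB : |blockDeviation α β P m N x| ≤ 3 * δ * m * N := by
    push_cast at h1 h2
    rw [abs_le]
    constructor <;> linarith
  have ha' : |(N : ℝ) * a - n * (a / m)| ≤ m := by
    have e1 : (N : ℝ) * a - n * (a / m) = -((n % m : ℕ) : ℝ) * (a / m) := by
      rw [← hNm]
      field_simp
      ring
    have e2 : |a / m| ≤ 1 := by
      rw [abs_div, abs_of_pos hm0, div_le_one hm0]
      exact abs_annealedMean_le h P m
    rw [e1, abs_mul, abs_neg, Nat.abs_cast]
    exact (mul_le_of_le_one_right (Nat.cast_nonneg _) e2).trans hmod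
  have hsum : (jumpChain α β x.1 x.2 n : ℝ) - n * (a / m) =
      ((jumpChain α β x.1 x.2 n : ℝ) - jumpChain α β x.1 x.2 (N * m)) +
        blockDeviation α β P m N x + ((N : ℝ) * a - n * (a / m)) := by
    unfold blockDeviation
    ring
  have htot : |(jumpChain α β x.1 x.2 n : ℝ) - n * (a / m)| ≤ 4 * δ * n := by
    rw [hsum]
    refine (abs_add_three _ _ _).trans ?_
    have h5 : (2 : ℝ) * m ≤ δ * n := by
      have h6 : (n₀ : ℝ) ≤ n := by exact_mod_cast h3
      have h7 := hn₀.le.trans h6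
      rw [div_le_iff₀ hδ] at h7
      linarith
    have h8 : 3 * δ * m * N ≤ 3 * δ * n := by
      have : (N : ℝ) * m ≤ n := by
        have := Nat.cast_nonneg (α := ℝ) (n % m)
        linarith
      have := mul_le_mul_of_nonneg_left this (by positivity : 0 ≤ 3 * δ)
      linarith
    linarith
  have e3 : (jumpChain α β x.1 x.2 n : ℝ) / n - a / m =
      ((jumpChain α β x.1 x.2 n : ℝ) - n * (a / m)) / n := by
    field_simp
  rw [e3, abs_div, abs_of_pos hn0, div_le_iff₀ hn0]
  exact htot

/-- If almost every trajectory is eventually within `4δ` of a deterministic number, for every `δ`,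
then it converges to a deterministic limit. -/
theorem exists_ae_tendsto_of_eventually_abs_sub_le {Ω : Type*} {mΩ : MeasurableSpace Ω}
    {Q : Measure Ω} [IsProbabilityMeasure Q] {f : ℕ → Ω → ℝ}
    (hf : ∀ δ : ℝ, 0 < δ → δ ≤ 1 →
      ∃ w : ℝ, ∀ᵐ x ∂Q, ∀ᶠ n : ℕ in atTop, |f n x - w| ≤ 4 * δ) :
    ∃ w : ℝ, ∀ᵐ x ∂Q, Tendsto (fun n => f n x) atTop (𝓝 w) := by
  have hf' : ∀ j : ℕ, ∃ w : ℝ, ∀ᵐ x ∂Q, ∀ᶠ n : ℕ in atTop,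
      |f n x - w| ≤ 4 * (1 / ((j : ℝ) + 1)) := fun j => by
    refine hf _ (by positivity) ?_
    rw [div_le_one (by positivity)]
    linarith [Nat.cast_nonneg (α := ℝ) j]
  choose w hw using hf'
  have hall := ae_all_iff.2 hw
  have hsmall : Tendsto (fun j : ℕ => 4 * (1 / ((j : ℝ) + 1))) atTop (𝓝 0) := by
    simpa using (tendsto_one_div_add_atTop_nhds_zero_nat (𝕜 := ℝ)).const_mul 4
  have hcauchy : ∀ x, (∀ j : ℕ, ∀ᶠ n : ℕ in atTop, |f n x - w j| ≤ 4 * (1 / ((j : ℝ) + 1))) →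
      ∀ i j : ℕ, |w i - w j| ≤ 4 * (1 / ((i : ℝ) + 1)) + 4 * (1 / ((j : ℝ) + 1)) := by
    intro x hx i j
    obtain ⟨n, hi, hj⟩ := ((hx i).and (hx j)).exists
    rw [abs_sub_comm] at hi
    exact (abs_sub_le (w i) (f n x) (w j)).trans (add_le_add hi hj)
  obtain ⟨x₀, hx₀⟩ := hall.exists
  have hw0 : ∀ i j, |w i - w j| ≤ _ := hcauchy x₀ hx₀
  have hwc : CauchySeq w := by
    rw [Metric.cauchySeq_iff']
    intro ε hε
    obtain ⟨K, hK⟩ := eventually_atTop.1 (hsmall.eventually_lt_const (half_pos hε))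
    refine ⟨K, fun n hn => ?_⟩
    rw [Real.dist_eq]
    linarith [hw0 n K, hK n hn, hK K le_rfl]
  obtain ⟨w₀, hw₀⟩ := cauchySeq_tendsto_of_complete hwc
  refine ⟨w₀, ?_⟩
  filter_upwards [hall] with x hx
  rw [Metric.tendsto_atTop']
  intro ε hε
  obtain ⟨j, hj1, hj2⟩ := ((hsmall.eventually_lt_const (half_pos hε)).and
    (Metric.tendsto_nhds.1 hw₀ (ε / 2) (half_pos hε))).exists
  obtain ⟨n, hn⟩ := eventually_atTop.1 (hx j)
  refine ⟨n, fun k hk => ?_⟩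
  rw [Real.dist_eq] at hj2 ⊢
  linarith [abs_sub_le (f k x) (w j) w₀, hn k hk.le]

theorem exists_ae_tendsto_jumpChain_div {S : ParticleSystem} {μ : Measure Config}
    [IsProbabilityMeasure μ] (h : 0 < α + β) (hstat : IsStationary (S.pathLaw μ))
    (hcone : IsConeMixing (S.pathLaw μ)) :
    ∃ w : ℝ, ∀ᵐ x ∂((S.pathLaw μ).prod (noiseLaw (α + β))),
      Tendsto (fun n : ℕ => (jumpChain α β x.1 x.2 n : ℝ) / n) atTop (𝓝 w) := by
  have := isProbabilityMeasure_pathLaw S μ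
  have := isProbabilityMeasure_noiseLaw h
  refine exists_ae_tendsto_of_eventually_abs_sub_le fun δ hδ hδ1 => ?_
  obtain ⟨m, hm, hdisp⟩ := exists_integral_past_mul_displacement_le h hstat hcone hδ
  exact ⟨_, ae_eventually_abs_jumpChain_div_sub_le h hδ hδ1 hm hdisp⟩

end ChainLLN

/-! ### The law of large numbers for the walk -/

section WalkLLN

variable {α β : ℝ}

theorem noExplosion_of_tendsto {ω : Noise} (h : Tendsto (jumpTime ω) atTop atTop) :
    NoExplosion ω := fun k =>
  ((h.comp (tendsto_add_atTop_nat 1)).eventually_gt_atTop (k : ℝ)).exists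

theorem lt_jumpTime_jumpCount_succ {ω : Noise} (h : NoExplosion ω) (t : ℝ≥0) :
    (t : ℝ) < jumpTime ω (jumpCount ω t + 1) := Nat.sInf_mem (h.exists_lt t)

theorem jumpTime_jumpCount_le (ω : Noise) (t : ℝ≥0) : jumpTime ω (jumpCount ω t) ≤ t := by
  rcases hn : jumpCount ω t with _ | n
  · simp [jumpTime]
  · by_contra hlt
    have : jumpCount ω t ≤ n := Nat.sInf_le (not_le.1 hlt)
    omega

theorem tendsto_jumpCount {ω : Noise} (h : NoExplosion ω) : Tendsto (jumpCount ω) atTop atTop := by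
  refine tendsto_atTop_atTop.2 fun K => ?_
  obtain ⟨t, ht⟩ := exists_nat_gt (∑ j ∈ Finset.range (K + 1), |jumpTime ω j|)
  refine ⟨t, fun s hs => ?_⟩
  by_contra hlt
  have h1 := lt_jumpTime_jumpCount_succ h s
  have h2 : |jumpTime ω (jumpCount ω s + 1)| ≤ ∑ j ∈ Finset.range (K + 1), |jumpTime ω j| :=
    Finset.single_le_sum (f := fun j => |jumpTime ω j|) (fun _ _ => abs_nonneg _)
      (Finset.mem_range.2 (by omega))
  have h3 : (t : ℝ) ≤ s := by exact_mod_cast hs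
  linarith [le_abs_self (jumpTime ω (jumpCount ω s + 1))]

theorem tendsto_jumpCount_div {ω : Noise} {a : ℝ} (ha : 0 < a)
    (h : Tendsto (fun n : ℕ => jumpTime ω n / n) atTop (𝓝 a)) (hne : NoExplosion ω) :
    Tendsto (fun t : ℝ≥0 => (jumpCount ω t : ℝ) / t) atTop (𝓝 a⁻¹) := by
  have hN := tendsto_jumpCount hne
  have hlow : Tendsto (fun t => jumpTime ω (jumpCount ω t) / jumpCount ω t) atTop (𝓝 a) :=
    h.comp hN
  have hsucc : Tendsto (fun n : ℕ => jumpTime ω (n + 1) / n) atTop (𝓝 a) := by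
    have h1 : Tendsto (fun n : ℕ => jumpTime ω (n + 1) / ((n + 1 : ℕ) : ℝ)) atTop (𝓝 a) :=
      h.comp (tendsto_add_atTop_nat 1)
    have h2 : Tendsto (fun n : ℕ => 1 + 1 / (n : ℝ)) atTop (𝓝 (1 + 0)) :=
      tendsto_one_div_atTop_nhds_zero_nat.const_add 1
    have h3 := h1.mul h2
    rw [add_zero, mul_one] at h3
    refine h3.congr' ?_
    filter_upwards [eventually_gt_atTop 0] with n hn
    have : (0 : ℝ) < n := by exact_mod_cast hn
    push_cast
    field_simp
  have hup : Tendsto (fun t => jumpTime ω (jumpCount ω t + 1) / jumpCount ω t) atTop (𝓝 a) :=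
    hsucc.comp hN
  have hmid : Tendsto (fun t : ℝ≥0 => (t : ℝ) / jumpCount ω t) atTop (𝓝 a) := by
    refine tendsto_of_tendsto_of_tendsto_of_le_of_le hlow hup (fun t => ?_) fun t => ?_
    · exact div_le_div_of_nonneg_right (jumpTime_jumpCount_le ω t) (Nat.cast_nonneg _)
    · exact div_le_div_of_nonneg_right (lt_jumpTime_jumpCount_succ hne t).le (Nat.cast_nonneg _)
  simpa only [inv_div] using hmid.inv₀ ha.ne'

theorem tendsto_walk_div {ξ : EnvPath} {ω : Noise} {a w : ℝ} (ha : 0 < a)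
    (hT : Tendsto (fun n : ℕ => jumpTime ω n / n) atTop (𝓝 a))
    (hY : Tendsto (fun n : ℕ => (jumpChain α β ξ ω n : ℝ) / n) atTop (𝓝 w)) :
    Tendsto (fun t : ℝ≥0 => (walk α β ξ ω t : ℝ) / t) atTop (𝓝 (w * a⁻¹)) := by
  have hne : NoExplosion ω := by
    refine noExplosion_of_tendsto ?_
    refine (hT.pos_mul_atTop ha tendsto_natCast_atTop_atTop).congr' ?_
    filter_upwards [eventually_gt_atTop 0] with n hn
    have : (0 : ℝ) < n := by exact_mod_cast hn
    field_simp
  have hN := tendsto_jumpCount hne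
  refine ((hY.comp hN).mul (tendsto_jumpCount_div ha hT hne)).congr' ?_
  filter_upwards [hN.eventually_gt_atTop 0] with t ht
  have : (0 : ℝ) < jumpCount ω t := by exact_mod_cast ht
  simp only [walk, hne, if_true, Function.comp_apply]
  field_simp

theorem annealedLaw_eq_map (α β : ℝ) (P : Measure EnvPath) [SFinite P] :
    annealedLaw α β P = (P.prod (noiseLaw (α + β))).map (walkPath α β) := by
  ext A hA
  rw [annealedLaw, Measure.bind_apply hA (quenchedLaw α β).measurable.aemeasurable,
    Measure.map_apply (measurable_walkPath α β) hA,
    Measure.prod_apply (measurable_walkPath α β hA)]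
  refine lintegral_congr fun ξ => ?_
  exact Measure.map_apply ((measurable_walkPath α β).comp measurable_prodMk_left) hA

/-- By right-continuity, the limit of `X_t / t` can be taken along a countable dense set of times;
hence its existence is an event. -/
theorem measurableSet_tendsto_div (v : ℝ) :
    MeasurableSet {X : CadlagPath ℤ | Tendsto (fun t : ℝ≥0 => (X.1 t : ℝ) / t) atTop (𝓝 v)} := by
  obtain ⟨D, hDc, hDd⟩ := TopologicalSpace.exists_countable_dense ℝ≥0
  have heq : {X : CadlagPath ℤ | Tendsto (fun t : ℝ≥0 => (X.1 t : ℝ) / t) atTop (𝓝 v)} =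
      ⋂ k : ℕ, ⋃ N : ℕ, ⋂ q ∈ D, {X : CadlagPath ℤ | (N : ℝ≥0) < q →
        |(X.1 q : ℝ) / q - v| ≤ 1 / ((k : ℝ) + 1)} := by
    ext X
    simp only [mem_ofPred_eq, mem_iInter, mem_iUnion]
    constructor
    · intro hX k
      have hk : (0 : ℝ) < 1 / ((k : ℝ) + 1) := by positivity
      obtain ⟨T, hT⟩ := eventually_atTop.1 (Metric.tendsto_nhds.1 hX _ hk)
      obtain ⟨N, hN⟩ := exists_nat_ge T
      exact ⟨N, fun q _ hq => (hT q (hN.trans hq.le)).le⟩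
    · intro hX
      rw [Metric.tendsto_atTop']
      intro ε hε
      obtain ⟨k, hk⟩ := exists_nat_one_div_lt hε
      obtain ⟨N, hN⟩ := hX k
      refine ⟨N, fun t ht => lt_of_le_of_lt ?_ hk⟩
      have ht0 : (t : ℝ) ≠ 0 := by
        have : 0 < t := lt_of_le_of_lt zero_le ht
        exact_mod_cast this.ne'
      have hcont : ContinuousWithinAt (fun s : ℝ≥0 => |(X.1 s : ℝ) / s - v|) (Ici t) t := by
        have h1 : ContinuousWithinAt (fun s : ℝ≥0 => (X.1 s : ℝ)) (Ici t) t :=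
          (continuous_of_discreteTopology (f := fun k : ℤ => (k : ℝ))).continuousAt
            |>.comp_continuousWithinAt (X.2 t).1
        exact ((h1.div NNReal.continuous_coe.continuousWithinAt ht0).sub
          continuousWithinAt_const).abs
      have hmem : t ∈ closure (D ∩ Ioi t) := by
        have := hDd.open_subset_closure_inter (isOpen_Ioi (a := t))
        rw [inter_comm] at this
        have h2 := closure_mono this
        rw [closure_closure, closure_Ioi] at h2
        exact h2 self_mem_Ici
      have hne : (𝓝[D ∩ Ioi t] t).NeBot := mem_closure_iff_nhdsWithin_neBot.1 hmem
      refine le_of_tendsto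
        (hcont.mono fun s hs => (mem_Ioi.1 hs.2).le : Tendsto _ (𝓝[D ∩ Ioi t] t) _) ?_
      filter_upwards [self_mem_nhdsWithin] with s hs
      exact hN s hs.1 (ht.trans hs.2)
  rw [heq]
  refine MeasurableSet.iInter fun k => MeasurableSet.iUnion fun N =>
    MeasurableSet.biInter hDc fun q _ => ?_
  by_cases hq : (N : ℝ≥0) < q
  · simp only [hq, true_imp_iff]
    have hm : Measurable fun X : CadlagPath ℤ => (X.1 q : ℝ) :=
      (measurable_of_countable (fun k : ℤ => (k : ℝ))).comp
        ((measurable_pi_apply q).comp measurable_subtype_coe)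
    exact measurableSet_le ((hm.div_const _).sub_const v).abs measurable_const
  · simp [hq]

end WalkLLN

end RWDRE

theorem mainTheorem1 (S : ParticleSystem) (μ : Measure Config) [IsProbabilityMeasure μ]
    (α β : ℝ) (hα : 0 < α) (hβ : 0 < β)
    (hstat : IsStationary (S.pathLaw μ)) (herg : IsErgodic (S.pathLaw μ))
    (hcone : IsConeMixing (S.pathLaw μ)) :
    ∃ v : ℝ, ∀ᵐ X ∂(annealedLaw α β (S.pathLaw μ)),
      Tendsto (fun t : ℝ≥0 => (X.1 t : ℝ) / (t : ℝ)) atTop (𝓝 v) := by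
  have h : 0 < α + β := add_pos hα hβ
  have := isProbabilityMeasure_pathLaw S μ
  have := isProbabilityMeasure_noiseLaw h
  obtain ⟨w, hw⟩ := exists_ae_tendsto_jumpChain_div h hstat hcone
  refine ⟨w * ((α + β)⁻¹)⁻¹, ?_⟩
  rw [annealedLaw_eq_map, ae_map_iff (measurable_walkPath α β).aemeasurable
    (measurableSet_tendsto_div _)]
  have hT : ∀ᵐ x ∂((S.pathLaw μ).prod (noiseLaw (α + β))),
      Tendsto (fun n : ℕ => jumpTime x.2 n / n) atTop (𝓝 (α + β)⁻¹) :=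
    Measure.quasiMeasurePreserving_snd.ae (ae_tendsto_jumpTime_div h)
  filter_upwards [hw, hT] with x hx hTx
  exact tendsto_walk_div (inv_pos.2 h) hTx hx
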